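/- \textbf{Setting.} Variables $i=1,\dots,N$ are divided into $S\ge 2$ groups, $g_i$ is the group of $i$, $N_j$ the size of group $j$, and $\iota_{ji}=\mathbb I(g_i=j)$. Over periods $t=1,\dots,T$, $$X_{it}=\lambda_{c,i}'f_{c,t}+\lambda_{g_i,i}'f_{g_i,t}+\lambda_{s,i}'f_{s,t}+e_{it},\qquad X=\Phi G'+e,$$ with $r_c$ common factors $f_{c,t}$, $r_j\ge 0$ factors $f_{j,t}$ specific to group $j$, and $r_s\ge 0$ factors $f_{s,t}$ that may affect the groups in different ways. Here $g_t=(f_{c,t}',f_{1,t}',\dots,f_{S,t}',f_{s,t}')'$ and $\phi_i$ (the rows of $G$ and $\Phi$) have length $r=r_c+r_1+\dots+r_S+r_s$, and $\phi_i$ contains $\lambda_{c,i}$, $\lambda_{g_i,i}$, $\lambda_{s,i}$ and zeros in the blocks of the other groups. The arrays may depend on the sample. $N,T\to\infty$, $\sqrt N/T\to 0$ and $N_j/N\to\pi_j\in(0,1)$. All $S$, $r_c,r_j,r_s$ are fixed, $C$ is a constant independent of $N,T$ and of all indices, $\|\cdot\|$ is the Euclidean/Frobenius norm, $M>0$ means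 positive definite, and limits $\Sigma$ are non-random. For positive definite $\Sigma_1,\Sigma_2$, a \emph{limit rotation} of $(\Sigma_1,\Sigma_2)$ is a square matrix $H$ with $HH'=\Sigma_2$ and $H'\Sigma_1H$ diagonal with decreasing diagonal entries (unique up to column signs when $\Sigma_1\Sigma_2$ has distinct eigenvalues). \textbf{Assumption 1.} (a) $\mathrm E\|f_{c,t}\|^4\le C$ and $\frac1T\sum_t f_{c,t}f_{c,t}'\to_P\Sigma_F>0$. (b) The $\lambda_{c,i}$ are independent across $i$, $\mathrm E(\lambda_{c,i}\lambda_{c,i}')=\Sigma_\Lambda>0$, $\mathrm E\|\lambda_{c,i}\|^8\le C$. (c) $\Sigma_F\Sigma_\Lambda$ has distinct eigenvalues. (d) $\mathrm E e_{it}=0$, $\mathrm E|e_{it}|^8\le C$. (e) $\sigma_{ij,ts}=\mathrm E(e_{it}e_{js})$ satisfies $|\sigma_{ij,ts}|\le\bar\sigma_{ij}$ and $|\sigma_{ij,ts}|\le\tau_{st}$ with $\frac1N\sum_{i,j}\bar\sigma_{ij}\le C$, $\frac1T\sum_{t,s}\tau_{st}\le C$, $\frac1{NT}\sum_{i,j,t,s}|\sigma_{ij,ts}|\le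 C$. (f) $\mathrm E|N^{-1/2}\sum_i(e_{it}e_{is}-\mathrm E e_{it}e_{is})|^4\le C$ for all $t,s$. (g) With $H_0$ a limit rotation of $(\Sigma_F,\Sigma_\Lambda)$, for every $j$ the matrix $\mathrm{Var}\big(\sqrt{N_j/N}\,\mathrm{Vech}(\frac{\sqrt N}{N_j}\sum_{g_i=j}H_0^{-1}(\lambda_{c,i}\lambda_{c,i}'-\Sigma_\Lambda)H_0'^{-1})\big)$ converges to the same positive definite matrix. (h) With $v_i=\mathrm{Vech}(H_0^{-1}\lambda_{c,i}\lambda_{c,i}'H_0'^{-1})$, $\mathrm E(v_iv_i')$ does not depend on $i$ or on the sample. \textbf{Assumption 2.} For $m=1,\dots,S$ and all $i,t$: (a) $\mathrm E\frac1N\sum_i\|T^{-1/2}\sum_tf_{c,t}e_{it}\iota_{mi}\|^2\le C$, $\mathrm E(f_{c,t}e_{it})=0$. (b) $\mathrm E\|(TN)^{-1/2}\sum_{s,i}f_{c,s}(e_{it}e_{is}-\mathrm Ee_{it}e_{is})\|^2\le C$. (c) $\mathrm E\|(TN)^{-1/2}\sum_{t,i}f_{c,t}\lambda_{c,i}'e_{it}\iota_{mi}\|^2\le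 C$, $\mathrm E(f_{c,t}\lambda_{c,i}'e_{it})=0$. (d) $\mathrm E\frac1T\sum_t\|N^{-1/2}\sum_i\lambda_{c,i}e_{it}\iota_{mi}\|^2\le C$, $\mathrm E(\lambda_{c,i}e_{it})=0$. \textbf{Assumption 3.} (a) $\frac1TG'G\to_P\Sigma_G>0$. (b) The $\phi_i$ are independent across $i$, $\mathrm E\|\phi_i\|^4\le C$, $\mathrm E(\phi_i\phi_i')=\Psi_j$ for $i$ in group $j$, with $\Psi_j$ fixed, and $\frac1N\Phi'\Phi\to_P\Sigma_\Phi>0$. (c) $\Sigma_G\Sigma_\Phi$ has distinct eigenvalues. (d) $\mathrm E\frac1N\sum_i\|T^{-1/2}\sum_tg_te_{it}\iota_{ji}\|^2\le C$ for every $j$, $\mathrm E(g_te_{it})=0$. (e) $\mathrm E\|(TN)^{-1/2}\sum_{s,i}g_s(e_{it}e_{is}-\mathrm Ee_{it}e_{is})\|^2\le C$ for every $t$. (f), (g) $\mathrm E\|(TN)^{-1/2}\sum_{t,i}g_t\phi_i'e_{it}\iota_{ji}\|^2\le C$ for every $j$, $\mathrm E(g_t\phi_i'e_{it})=0$. (h)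 With $\Xi_0$ a limit rotation of $(\Sigma_G,\Sigma_\Phi)$, for all $j\ne k$, $S(j,k,\Phi\Xi_0'^{-1})\to_P S_0(j,k)>0$, where $S$ is defined next. \textbf{Statistics.} For an $N\times r$ matrix $L$ with rows $\ell_i'$ put $$A(j,k,L)=\mathrm{Vech}\Big(\sqrt N\Big(\tfrac1{N_j}\sum_{g_i=j}\ell_i\ell_i'-\tfrac1{N_k}\sum_{g_i=k}\ell_i\ell_i'\Big)\Big),$$ $$S(j,k,L)=\Big(\tfrac N{N_j}+\tfrac N{N_k}\Big)\tfrac1N\sum_{i=1}^N\mathrm{Vech}(\ell_i\ell_i'-I)\,\mathrm{Vech}(\ell_i\ell_i'-I)',$$ $LM_N(j,k,L)=A(j,k,L)'S(j,k,L)^{-1}A(j,k,L)$, $LM_{1N}=\max_{j<k}LM_N(j,k,\hat\Lambda)$ and $LM_{2N}=\min_{j<k}LM_N(j,k,\hat\Lambda)$, where the columns of $\hat\Lambda$ are $\sqrt N$ times orthonormal eigenvectors of $XX'$ for its $r$ largest eigenvalues. \textbf{Alternatives.} Heterogeneity emerges in the pair $(j,k)$ if $r_j>0$ or $r_k>0$,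 or if $\mathrm E(\lambda_{s,i}\lambda_{s,i}')$ or $\mathrm E(\lambda_{c,i}\lambda_{s,i}')$ differs between the two groups. $H_1$: this happens for at least one pair $j<k$. $H_2$: it happens for all pairs $j<k$. \textbf{Theorem.} Suppose that Assumptions 1, 2 and 3 hold, and put $R_0(j,k)=\Xi_0^{-1}(\Psi_j-\Psi_k)\Xi_0'^{-1}$ and $$\delta_1=\max_{j<k}\mathrm{Vech}(R_0(j,k))'S_0(j,k)^{-1}\mathrm{Vech}(R_0(j,k)),\qquad \delta_2=\min_{j<k}\mathrm{Vech}(R_0(j,k))'S_0(j,k)^{-1}\mathrm{Vech}(R_0(j,k)).$$ As $N,T\to\infty$ with $\sqrt N/T\to0$: under $H_1$, $\delta_1>0$, $LM_{1N}=N\delta_1+o_P(N)$, and $P(LM_{1N}\le c)\to0$ for every real $c$; under $H_2$, $\delta_2>0$, $LM_{2N}=N\delta_2+o_P(N)$, and $P(LM_{2N}\le c)\to0$ for every real $c$. Hence both tests are consistent. -/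

import Mathlib

open MeasureTheory ProbabilityTheory Filter
open scoped Matrix Topology

namespace GroupFactor

noncomputable section

/-! ### Vectors and matrices -/

/-- Squared Euclidean norm of a vector. -/
def sqNorm {ι : Type*} [Fintype ι] (v : ι → ℝ) : ℝ := ∑ a, v a ^ 2

/-- Squared Frobenius norm of a matrix. -/
def sqFrob {ι κ : Type*} [Fintype ι] [Fintype κ] (M : Matrix ι κ ℝ) : ℝ :=
  ∑ a, ∑ b, M a b ^ 2

/-- Positions `(a, b)`, `b ≤ a`, of the lower triangle of an `r × r` matrix. -/
abbrev VechIdx (r : ℕ) : Type := {p : Fin r × Fin r // p.2 ≤ p.1}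

/-- Half-vectorization: the entries on and below the diagonal. -/
def vech {r : ℕ} (M : Matrix (Fin r) (Fin r) ℝ) : VechIdx r → ℝ := fun p => M p.1.1 p.1.2

/-- All complex eigenvalues of a real square matrix are pairwise distinct. -/
def DistinctEigenvalues {r : ℕ} (M : Matrix (Fin r) (Fin r) ℝ) : Prop :=
  (M.charpoly.map (algebraMap ℝ ℂ)).roots.Nodup

/-- `H` is the limit rotation belonging to the factor second moment `SF` and the loading second
moment `SL`. Principal components normalize the estimated loadings by `L̂ᵀ L̂ / N = 1` and make
`F̂ᵀ F̂ / T` diagonal with decreasing entries, where `L̂ ≈ L (Hᵀ)⁻¹` and `F̂ ≈ F H`; in the limit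
this says `H⁻¹ SL (Hᵀ)⁻¹ = 1` and that `Hᵀ SF H` is diagonal with decreasing entries. When the
eigenvalues of `SF * SL` are distinct, `H` is determined up to the signs of its columns. -/
def IsLimitRotation {r : ℕ} (SF SL H : Matrix (Fin r) (Fin r) ℝ) : Prop :=
  H * Hᵀ = SL ∧ ∃ d : Fin r → ℝ, Antitone d ∧ Hᵀ * SF * H = Matrix.diagonal d

/-! ### Probability -/

/-- `f` has a finite mean, equal to `m`. -/
def HasMean {Ω : Type*} [MeasurableSpace Ω] (μ : Measure Ω) (f : Ω → ℝ) (m : ℝ) : Prop :=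
  Integrable f μ ∧ ∫ ω, f ω ∂μ = m

/-- `f` has a finite mean, at most `C`. -/
def MeanLe {Ω : Type*} [MeasurableSpace Ω] (μ : Measure Ω) (f : Ω → ℝ) (C : ℝ) : Prop :=
  Integrable f μ ∧ ∫ ω, f ω ∂μ ≤ C

/-- Entrywise convergence in probability of random matrices to a constant matrix. -/
def MatTendstoP {Ω : Type*} [MeasurableSpace Ω] (μ : Measure Ω) {ι κ : Type*}
    (M : ℕ → Ω → Matrix ι κ ℝ) (L : Matrix ι κ ℝ) : Prop :=
  ∀ a b, TendstoInMeasure μ (fun n ω => M n ω a b) atTop (fun _ => L a b)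

/-- `Z n = o_P(a n)`. -/
def IsLittleOP {Ω : Type*} [MeasurableSpace Ω] (μ : Measure Ω) (Z : ℕ → Ω → ℝ) (a : ℕ → ℝ) :
    Prop :=
  TendstoInMeasure μ (fun n ω => Z n ω / a n) atTop (fun _ => 0)

/-! ### The test statistics -/

/-- Number of variables in group `j`. -/
def groupSize {N S : ℕ} (grp : Fin N → Fin S) (j : Fin S) : ℕ :=
  (Finset.univ.filter fun i => grp i = j).card

/-- Indicator of the event that variable `i` belongs to group `j`. -/
def groupInd {N S : ℕ} (grp : Fin N → Fin S) (j : Fin S) (i : Fin N) : ℝ :=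
  if grp i = j then 1 else 0

/-- `(1 / N_j) ∑_{i in group j} ℓ_i ℓ_iᵀ`, where `ℓ_i` is the `i`-th row of `L`. -/
def groupMoment {N S r : ℕ} (grp : Fin N → Fin S) (L : Matrix (Fin N) (Fin r) ℝ) (j : Fin S) :
    Matrix (Fin r) (Fin r) ℝ :=
  (1 / (groupSize grp j : ℝ)) •
    ∑ i ∈ Finset.univ.filter (fun i => grp i = j), Matrix.vecMulVec (L i) (L i)

/-- The vector `A(j, k, L)`. -/
def statA {N S r : ℕ} (grp : Fin N → Fin S) (j k : Fin S) (L : Matrix (Fin N) (Fin r) ℝ) :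
    VechIdx r → ℝ :=
  vech (Real.sqrt N • (groupMoment grp L j - groupMoment grp L k))

/-- The variance estimator `S(j, k, L)`. -/
def statS {N S r : ℕ} (grp : Fin N → Fin S) (j k : Fin S) (L : Matrix (Fin N) (Fin r) ℝ) :
    Matrix (VechIdx r) (VechIdx r) ℝ :=
  ((N : ℝ) / groupSize grp j + (N : ℝ) / groupSize grp k) • (1 / (N : ℝ)) •
    ∑ i, Matrix.vecMulVec (vech (Matrix.vecMulVec (L i) (L i) - 1))
      (vech (Matrix.vecMulVec (L i) (L i) - 1))

/-- `LM_N(j, k, L) = A(j, k, L)ᵀ S(j, k, L)⁻¹ A(j, k, L)`. -/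
def statLM {N S r : ℕ} (grp : Fin N → Fin S) (j k : Fin S) (L : Matrix (Fin N) (Fin r) ℝ) : ℝ :=
  statA grp j k L ⬝ᵥ ((statS grp j k L)⁻¹ *ᵥ statA grp j k L)

/-- The pairs of groups `j < k`. -/
abbrev GroupPair (S : ℕ) : Type := {p : Fin S × Fin S // p.1 < p.2}

/-- `LM_{1N}`: the maximum of `LM_N` over the pairs of groups. -/
def statLM1 {N S r : ℕ} (grp : Fin N → Fin S) (L : Matrix (Fin N) (Fin r) ℝ) : ℝ :=
  ⨆ p : GroupPair S, statLM grp p.1.1 p.1.2 L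

/-- `LM_{2N}`: the minimum of `LM_N` over the pairs of groups. -/
def statLM2 {N S r : ℕ} (grp : Fin N → Fin S) (L : Matrix (Fin N) (Fin r) ℝ) : ℝ :=
  ⨅ p : GroupPair S, statLM grp p.1.1 p.1.2 L

/-- `L` is a principal component estimate of the loadings from the `N × T` data matrix `X`: its
columns are `√N` times orthonormal eigenvectors of `X Xᵀ` that belong to the `r` largest
eigenvalues `v`. The last clause says that on the orthogonal complement of the columns the
quadratic form of `X Xᵀ`, hence every remaining eigenvalue, is bounded by each `v l`. -/
def IsPCLoadings {N T r : ℕ} (X : Matrix (Fin N) (Fin T) ℝ) (L : Matrix (Fin N) (Fin r) ℝ) :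
    Prop :=
  Lᵀ * L = (N : ℝ) • (1 : Matrix (Fin r) (Fin r) ℝ) ∧
  ∃ v : Fin r → ℝ, Antitone v ∧ X * Xᵀ * L = L * Matrix.diagonal v ∧
    ∀ w : Fin N → ℝ, Lᵀ *ᵥ w = 0 → ∀ l, w ⬝ᵥ ((X * Xᵀ) *ᵥ w) ≤ v l * (w ⬝ᵥ w)

/-! ### The group-heterogeneous factor model -/

/-- Position, in the list `1, …, r`, of the factors: first the `rc` common factors, then the
`rg j` factors specific to group `j`, for `j = 1, …, S`, then the `rs` factors that may affect
several groups in different ways. -/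
def facEquiv (S rc rs : ℕ) (rg : Fin S → ℕ) :
    (Fin rc ⊕ (Σ j : Fin S, Fin (rg j))) ⊕ Fin rs ≃ Fin (rc + ∑ j, rg j + rs) :=
  (Equiv.sumCongr ((Equiv.sumCongr (Equiv.refl _) finSigmaFinEquiv).trans finSumFinEquiv)
    (Equiv.refl _)).trans finSumFinEquiv

/-- Stack a common, group-specific, and shared block into one vector of length `r`. -/
def stack {S rc rs : ℕ} {rg : Fin S → ℕ} (c : Fin rc → ℝ) (s : (j : Fin S) → Fin (rg j) → ℝ)
    (h : Fin rs → ℝ) : Fin (rc + ∑ j, rg j + rs) → ℝ :=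
  fun a => Sum.elim (Sum.elim c (fun q => s q.1 q.2)) h ((facEquiv S rc rs rg).symm a)

/-- A sequence of panels with `N n` variables in `S` groups and `T n` periods: the factors, the
loadings and the idiosyncratic errors. They may all depend on `n` (a triangular array). -/
structure Panel (Ω : Type*) (S rc rs : ℕ) (rg : Fin S → ℕ) where
  /-- number of variables -/
  N : ℕ → ℕ
  /-- number of periods -/
  T : ℕ → ℕ
  /-- group of each variable -/
  grp : (n : ℕ) → Fin (N n) → Fin S
  /-- common factors -/
  fc : (n : ℕ) → Fin (T n) → Ω → Fin rc → ℝ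
  /-- factors specific to group `j` -/
  fg : (n : ℕ) → Fin (T n) → Ω → (j : Fin S) → Fin (rg j) → ℝ
  /-- factors that may affect several groups in different ways -/
  fs : (n : ℕ) → Fin (T n) → Ω → Fin rs → ℝ
  /-- loadings on the common factors -/
  lc : (n : ℕ) → Fin (N n) → Ω → Fin rc → ℝ
  /-- loadings on the group-specific factors; only those of the variable's own group matter -/
  lg : (n : ℕ) → Fin (N n) → Ω → (j : Fin S) → Fin (rg j) → ℝ
  /-- loadings on the factors `fs` -/
  ls : (n : ℕ) → Fin (N n) → Ω → Fin rs → ℝ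
  /-- idiosyncratic errors -/
  e : (n : ℕ) → Fin (N n) → Fin (T n) → Ω → ℝ

namespace Panel

/-- The total number `r` of factors. -/
abbrev r {Ω : Type*} {S rc rs : ℕ} {rg : Fin S → ℕ} (_ : Panel Ω S rc rs rg) : ℕ :=
  rc + ∑ j, rg j + rs

/-- The vector `g_t` of all factors. -/
def g {Ω : Type*} {S rc rs : ℕ} {rg : Fin S → ℕ} (D : Panel Ω S rc rs rg) (n : ℕ)
    (t : Fin (D.T n)) (ω : Ω) : Fin D.r → ℝ :=
  stack (D.fc n t ω) (D.fg n t ω) (D.fs n t ω)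

/-- The vector `φ_i` of all loadings: the loadings on the specific factors of groups other than
the group of `i` are zero. -/
def phi {Ω : Type*} {S rc rs : ℕ} {rg : Fin S → ℕ} (D : Panel Ω S rc rs rg) (n : ℕ)
    (i : Fin (D.N n)) (ω : Ω) : Fin D.r → ℝ :=
  stack (D.lc n i ω) (fun j => if D.grp n i = j then D.lg n i ω j else 0) (D.ls n i ω)

/-- The `N × r` matrix of loadings, with rows `φ_iᵀ`. -/
def Phi {Ω : Type*} {S rc rs : ℕ} {rg : Fin S → ℕ} (D : Panel Ω S rc rs rg) (n : ℕ)
    (ω : Ω) : Matrix (Fin (D.N n)) (Fin D.r) ℝ :=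
  Matrix.of fun i => D.phi n i ω

/-- The `T × r` matrix of factors, with rows `g_tᵀ`. -/
def G {Ω : Type*} {S rc rs : ℕ} {rg : Fin S → ℕ} (D : Panel Ω S rc rs rg) (n : ℕ)
    (ω : Ω) : Matrix (Fin (D.T n)) (Fin D.r) ℝ :=
  Matrix.of fun t => D.g n t ω

/-- The `N × T` matrix of errors. -/
def err {Ω : Type*} {S rc rs : ℕ} {rg : Fin S → ℕ} (D : Panel Ω S rc rs rg) (n : ℕ)
    (ω : Ω) : Matrix (Fin (D.N n)) (Fin (D.T n)) ℝ :=
  Matrix.of fun i t => D.e n i t ω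

/-- The observed `N × T` data matrix `X = Φ Gᵀ + e`. -/
def X {Ω : Type*} {S rc rs : ℕ} {rg : Fin S → ℕ} (D : Panel Ω S rc rs rg) (n : ℕ)
    (ω : Ω) : Matrix (Fin (D.N n)) (Fin (D.T n)) ℝ :=
  D.Phi n ω * (D.G n ω)ᵀ + D.err n ω

/-- All factors, loadings and errors are random variables. -/
structure IsMeasurable {Ω : Type*} [MeasurableSpace Ω] {S rc rs : ℕ} {rg : Fin S → ℕ}
    (D : Panel Ω S rc rs rg) : Prop where
  g : ∀ n t, Measurable (D.g n t)
  phi : ∀ n i, Measurable (D.phi n i)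
  e : ∀ n i t, Measurable (D.e n i t)

/-- `N, T → ∞`, `√N / T → 0`, and `N_j / N → π_j ∈ (0, 1)` for every group. -/
structure Asymptotics {Ω : Type*} {S rc rs : ℕ} {rg : Fin S → ℕ}
    (D : Panel Ω S rc rs rg) (pr : Fin S → ℝ) : Prop where
  N_tendsto : Tendsto D.N atTop atTop
  T_tendsto : Tendsto D.T atTop atTop
  rate : Tendsto (fun n => Real.sqrt (D.N n) / (D.T n : ℝ)) atTop (𝓝 0)
  share : ∀ j, Tendsto (fun n => (groupSize (D.grp n) j : ℝ) / (D.N n : ℝ)) atTop (𝓝 (pr j))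
  share_pos : ∀ j, 0 < pr j
  share_lt_one : ∀ j, pr j < 1

/-- The error covariance `σ_{ij,ts} = E (e_it e_js)`. -/
def sigma {Ω : Type*} [MeasurableSpace Ω] {S rc rs : ℕ} {rg : Fin S → ℕ}
    (D : Panel Ω S rc rs rg) (μ : Measure Ω) (n : ℕ) (i j : Fin (D.N n)) (t s : Fin (D.T n)) : ℝ :=
  ∫ ω, D.e n i t ω * D.e n j s ω ∂μ

/-- The vector `A_0(j, Λ (H0ᵀ)⁻¹)` of centered and rotated common loadings of group `j`. -/
def A0 {Ω : Type*} {S rc rs : ℕ} {rg : Fin S → ℕ} (D : Panel Ω S rc rs rg)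
    (SL H0 : Matrix (Fin rc) (Fin rc) ℝ) (n : ℕ) (j : Fin S) (ω : Ω) : VechIdx rc → ℝ :=
  vech ((Real.sqrt (D.N n) / (groupSize (D.grp n) j : ℝ)) •
    ∑ i ∈ Finset.univ.filter (fun i => D.grp n i = j),
      H0⁻¹ * (Matrix.vecMulVec (D.lc n i ω) (D.lc n i ω) - SL) * (H0ᵀ)⁻¹)

/-- Assumptions on the common factors, the common loadings and the idiosyncratic errors. -/
structure FactorModel {Ω : Type*} [MeasurableSpace Ω] {S rc rs : ℕ} {rg : Fin S → ℕ}
    (D : Panel Ω S rc rs rg) (μ : Measure Ω) (C : ℝ)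
    (SF SL H0 : Matrix (Fin rc) (Fin rc) ℝ)
    (S0 SLL : Matrix (VechIdx rc) (VechIdx rc) ℝ) : Prop where
  fc_moment : ∀ n t, MeanLe μ (fun ω => sqNorm (D.fc n t ω) ^ 2) C
  fc_limit : MatTendstoP μ
    (fun n ω => (1 / (D.T n : ℝ)) • ∑ t, Matrix.vecMulVec (D.fc n t ω) (D.fc n t ω)) SF
  SF_posDef : SF.PosDef
  lc_indep : ∀ n, iIndepFun (fun i => D.lc n i) μ
  lc_second : ∀ n i a b, HasMean μ (fun ω => D.lc n i ω a * D.lc n i ω b) (SL a b)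
  SL_posDef : SL.PosDef
  lc_moment : ∀ n i, MeanLe μ (fun ω => sqNorm (D.lc n i ω) ^ 4) C
  distinct : DistinctEigenvalues (SF * SL)
  rotation : IsLimitRotation SF SL H0
  e_mean : ∀ n i t, HasMean μ (D.e n i t) 0
  e_moment : ∀ n i t, MeanLe μ (fun ω => |D.e n i t ω| ^ 8) C
  e_dep : ∀ n, ∃ (sbar : Fin (D.N n) → Fin (D.N n) → ℝ) (tau : Fin (D.T n) → Fin (D.T n) → ℝ),
    (∀ i j t s, |D.sigma μ n i j t s| ≤ sbar i j) ∧
    (∀ i j t s, |D.sigma μ n i j t s| ≤ tau s t) ∧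
    (1 / (D.N n : ℝ)) * ∑ i, ∑ j, sbar i j ≤ C ∧
    (1 / (D.T n : ℝ)) * ∑ t, ∑ s, tau s t ≤ C ∧
    (1 / ((D.N n : ℝ) * (D.T n : ℝ))) * ∑ i, ∑ j, ∑ t, ∑ s, |D.sigma μ n i j t s| ≤ C
  e_cross : ∀ n t s, MeanLe μ (fun ω => |(1 / Real.sqrt (D.N n)) *
    ∑ i, (D.e n i t ω * D.e n i s ω - D.sigma μ n i i t s)| ^ 4) C
  var_limit : ∀ j p q, Tendsto (fun n => covariance
      (fun ω => Real.sqrt ((groupSize (D.grp n) j : ℝ) / (D.N n : ℝ)) * D.A0 SL H0 n j ω p)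
      (fun ω => Real.sqrt ((groupSize (D.grp n) j : ℝ) / (D.N n : ℝ)) * D.A0 SL H0 n j ω q) μ)
    atTop (𝓝 (S0 p q))
  S0_posDef : S0.PosDef
  lc_fourth : ∀ n i p q, HasMean μ (fun ω =>
    vech (H0⁻¹ * Matrix.vecMulVec (D.lc n i ω) (D.lc n i ω) * (H0ᵀ)⁻¹) p *
    vech (H0⁻¹ * Matrix.vecMulVec (D.lc n i ω) (D.lc n i ω) * (H0ᵀ)⁻¹) q) (SLL p q)

/-- Moment conditions and weak dependence among the common factors, their loadings, and the
errors. -/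
structure WeakDependence {Ω : Type*} [MeasurableSpace Ω] {S rc rs : ℕ} {rg : Fin S → ℕ}
    (D : Panel Ω S rc rs rg) (μ : Measure Ω) (C : ℝ) : Prop where
  fe : ∀ n m, MeanLe μ (fun ω => (1 / (D.N n : ℝ)) * ∑ i, sqNorm (fun a =>
    (1 / Real.sqrt (D.T n)) * ∑ t, D.fc n t ω a * D.e n i t ω * groupInd (D.grp n) m i)) C
  fe_mean : ∀ n i t a, HasMean μ (fun ω => D.fc n t ω a * D.e n i t ω) 0
  fee : ∀ n t, MeanLe μ (fun ω => sqNorm (fun a =>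
    (1 / Real.sqrt ((D.T n : ℝ) * (D.N n : ℝ))) * ∑ s, ∑ i, D.fc n s ω a *
      (D.e n i t ω * D.e n i s ω - D.sigma μ n i i t s))) C
  fle : ∀ n m, MeanLe μ (fun ω => sqFrob (Matrix.of fun a b =>
    (1 / Real.sqrt ((D.T n : ℝ) * (D.N n : ℝ))) * ∑ t, ∑ i,
      D.fc n t ω a * D.lc n i ω b * D.e n i t ω * groupInd (D.grp n) m i)) C
  fle_mean : ∀ n i t a b, HasMean μ (fun ω => D.fc n t ω a * D.lc n i ω b * D.e n i t ω) 0
  le : ∀ n m, MeanLe μ (fun ω => (1 / (D.T n : ℝ)) * ∑ t, sqNorm (fun a =>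
    (1 / Real.sqrt (D.N n)) * ∑ i, D.lc n i ω a * D.e n i t ω * groupInd (D.grp n) m i)) C
  le_mean : ∀ n i t a, HasMean μ (fun ω => D.lc n i ω a * D.e n i t ω) 0

/-- Additional conditions for the group-heterogeneous factor model. `SG` and `SPhi` are the
limits of `Gᵀ G / T` and `Φᵀ Φ / N`, `Psi j` is the second moment of the loadings in group `j`,
`Xi0` the limit rotation, and `S0 j k` the limit of the variance estimator. -/
structure Heterogeneous {Ω : Type*} [MeasurableSpace Ω] {S rc rs : ℕ} {rg : Fin S → ℕ}
    (D : Panel Ω S rc rs rg) (μ : Measure Ω) (C : ℝ)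
    (SG SPhi Xi0 : Matrix (Fin D.r) (Fin D.r) ℝ) (Psi : Fin S → Matrix (Fin D.r) (Fin D.r) ℝ)
    (S0 : Fin S → Fin S → Matrix (VechIdx D.r) (VechIdx D.r) ℝ) : Prop where
  g_limit : MatTendstoP μ
    (fun n ω => (1 / (D.T n : ℝ)) • ∑ t, Matrix.vecMulVec (D.g n t ω) (D.g n t ω)) SG
  SG_posDef : SG.PosDef
  phi_indep : ∀ n, iIndepFun (fun i => D.phi n i) μ
  phi_moment : ∀ n i, MeanLe μ (fun ω => sqNorm (D.phi n i ω) ^ 2) C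
  phi_second : ∀ n i a b,
    HasMean μ (fun ω => D.phi n i ω a * D.phi n i ω b) (Psi (D.grp n i) a b)
  phi_limit : MatTendstoP μ
    (fun n ω => (1 / (D.N n : ℝ)) • ∑ i, Matrix.vecMulVec (D.phi n i ω) (D.phi n i ω)) SPhi
  SPhi_posDef : SPhi.PosDef
  distinct : DistinctEigenvalues (SG * SPhi)
  rotation : IsLimitRotation SG SPhi Xi0
  ge : ∀ n m, MeanLe μ (fun ω => (1 / (D.N n : ℝ)) * ∑ i, sqNorm (fun a =>
    (1 / Real.sqrt (D.T n)) * ∑ t, D.g n t ω a * D.e n i t ω * groupInd (D.grp n) m i)) C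
  ge_mean : ∀ n i t a, HasMean μ (fun ω => D.g n t ω a * D.e n i t ω) 0
  gee : ∀ n t, MeanLe μ (fun ω => sqNorm (fun a =>
    (1 / Real.sqrt ((D.T n : ℝ) * (D.N n : ℝ))) * ∑ s, ∑ i, D.g n s ω a *
      (D.e n i t ω * D.e n i s ω - D.sigma μ n i i t s))) C
  gpe : ∀ n m, MeanLe μ (fun ω => sqFrob (Matrix.of fun a b =>
    (1 / Real.sqrt ((D.T n : ℝ) * (D.N n : ℝ))) * ∑ t, ∑ i,
      D.g n t ω a * D.phi n i ω b * D.e n i t ω * groupInd (D.grp n) m i)) C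
  gpe_mean : ∀ n i t a b, HasMean μ (fun ω => D.g n t ω a * D.phi n i ω b * D.e n i t ω) 0
  S0_limit : ∀ j k, j ≠ k →
    MatTendstoP μ (fun n ω => statS (D.grp n) j k (D.Phi n ω * (Xi0ᵀ)⁻¹)) (S0 j k)
  S0_posDef : ∀ j k, j ≠ k → (S0 j k).PosDef

/-- Heterogeneity emerges in the pair of groups `(j, k)`: one of the groups has factors of its
own, or the loadings on the shared factors have different second moments, or different cross
moments with the common loadings, in the two groups. -/
def HeterogeneousPair {Ω : Type*} {S rc rs : ℕ} {rg : Fin S → ℕ} (D : Panel Ω S rc rs rg)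
    (Psi : Fin S → Matrix (Fin D.r) (Fin D.r) ℝ) (j k : Fin S) : Prop :=
  0 < rg j ∨ 0 < rg k ∨
  (∃ a b : Fin rs,
    Psi j (facEquiv S rc rs rg (Sum.inr a)) (facEquiv S rc rs rg (Sum.inr b)) ≠
    Psi k (facEquiv S rc rs rg (Sum.inr a)) (facEquiv S rc rs rg (Sum.inr b))) ∨
  (∃ (a : Fin rc) (b : Fin rs),
    Psi j (facEquiv S rc rs rg (Sum.inl (Sum.inl a))) (facEquiv S rc rs rg (Sum.inr b)) ≠
    Psi k (facEquiv S rc rs rg (Sum.inl (Sum.inl a))) (facEquiv S rc rs rg (Sum.inr b)))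

end Panel

/-- `R_0(j, k) = Ξ_0⁻¹ (Ψ_j - Ψ_k) (Ξ_0ᵀ)⁻¹`. -/
def R0 {S r : ℕ} (Xi0 : Matrix (Fin r) (Fin r) ℝ) (Psi : Fin S → Matrix (Fin r) (Fin r) ℝ)
    (j k : Fin S) : Matrix (Fin r) (Fin r) ℝ :=
  Xi0⁻¹ * (Psi j - Psi k) * (Xi0ᵀ)⁻¹

/-- `Vech(R_0(j, k))ᵀ S_0(j, k)⁻¹ Vech(R_0(j, k))`. -/
def pairDelta {S r : ℕ} (Xi0 : Matrix (Fin r) (Fin r) ℝ)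
    (Psi : Fin S → Matrix (Fin r) (Fin r) ℝ)
    (S0 : Fin S → Fin S → Matrix (VechIdx r) (VechIdx r) ℝ) (j k : Fin S) : ℝ :=
  vech (R0 Xi0 Psi j k) ⬝ᵥ ((S0 j k)⁻¹ *ᵥ vech (R0 Xi0 Psi j k))

end

end GroupFactor

namespace GroupFactor

/-! ### Convergence in probability as convergence along a filter -/

/-! Since `statA` carries a factor `√N`, the quotient of the statistic of a pair by `N` is a
quadratic form in the difference of two group moments, weighted by the inverse of `statS`. The
theorem follows once this quotient tends to `pairDelta` for every pair and `pairDelta` is positive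
for heterogeneous pairs: maxima and minima over finitely many pairs are continuous, and a statistic
growing like `N δ` with `δ > 0` leaves every bounded set.

The limit of the quotient rests on the estimated loadings. Write `X Xᵀ / (N T)` as `Φ A Φᵀ / N + E`
with `A = Gᵀ G / T`. The moment bounds and `√N / T → 0` give `√N ‖E‖² → 0` in probability
(`tendsto_sqFrob_err_mul_transpose`, `tendsto_sqFrob_err_mul_G`, `sqrt_mul_sqFrob_deviation_le`).
The eigenvector equation shows that any limit `P` of `Φᵀ L / N` is a limit rotation
(`exists_pc_limit`). Such a rotation equals `Xi0` up to column signs because the eigenvalues are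
distinct (`IsLimitRotation.eq_mul_diagonal`). Solving the eigenvector equation for `L` then shows
that, after these sign changes, `L` is close to `Φ (Xi0ᵀ)⁻¹` in average fourth power
(`exists_signs_tendsto_loadings`). Fourth powers are the right scale because `statS` is quartic in
the loadings. The statistic ignores column signs (`statLM_mul_signs`), so the estimated loadings may
be replaced by the rotated true ones. For these the group moments obey a law of large numbers
(`tendsto_groupMoment_Phi`), and `statS` converges by hypothesis.

Positivity reduces to `Psi j ≠ Psi k`, since `S0 j k` is positive definite and conjugation by the
invertible `Xi0` loses nothing. The case that needs an argument is a factor specific to one group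
(`Psi_groupSpecific`).

Convergence in probability is treated as convergence along one filter on `ℕ × Ω`. Ultrafilters finer
than it replace extraction of subsequences, and the estimates `Lhat` need not be measurable. -/

/-- The filter of the events on `ℕ × Ω` whose sections have probability tending to one. A sequence
of functions converges in probability to a constant exactly when it converges along this filter,
whether or not the functions are measurable. -/
def probFilter {Ω : Type*} [MeasurableSpace Ω] (μ : Measure Ω) : Filter (ℕ × Ω) where
  sets := {A | Tendsto (fun n => μ {ω | (n, ω) ∉ A}) atTop (𝓝 0)}
  univ_sets := by simp
  sets_of_superset := by
    intro A B hA hAB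
    refine tendsto_of_tendsto_of_tendsto_of_le_of_le tendsto_const_nhds hA (fun _ => zero_le) ?_
    intro n
    exact measure_mono fun ω hω hA => hω (hAB hA)
  inter_sets := by
    intro A B hA hB
    have h := Tendsto.add hA hB
    rw [add_zero] at h
    refine tendsto_of_tendsto_of_tendsto_of_le_of_le tendsto_const_nhds h (fun _ => zero_le) ?_
    intro n
    refine (measure_mono ?_).trans (measure_union_le _ _)
    intro ω hω
    by_cases h : (n, ω) ∈ A
    · exact Or.inr fun h' => hω ⟨h, h'⟩
    · exact Or.inl h

section

variable {Ω : Type*} [MeasurableSpace Ω] {μ : Measure Ω}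

theorem eventually_probFilter {p : ℕ × Ω → Prop} :
    (∀ᶠ x in probFilter μ, p x) ↔ Tendsto (fun n => μ {ω | ¬ p (n, ω)}) atTop (𝓝 0) :=
  Iff.rfl

/-- Entry point for facts that are not asymptotic in probability: deterministic statements about
sample sizes, and the almost sure defining property of the estimates. -/
theorem eventually_probFilter_of_ae {p : ℕ → Ω → Prop} (h : ∀ᶠ n in atTop, ∀ᵐ ω ∂μ, p n ω) :
    ∀ᶠ x in probFilter μ, p x.1 x.2 := by
  rw [eventually_probFilter]
  refine tendsto_const_nhds.congr' ?_
  filter_upwards [h] with n hn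
  exact (ae_iff.1 hn).symm

theorem tendsto_fst_probFilter : Tendsto Prod.fst (probFilter μ) atTop := by
  intro A hA
  exact eventually_probFilter_of_ae (p := fun n _ => n ∈ A)
    (Filter.Eventually.mono hA fun n hn => ae_of_all _ fun _ => hn)

/-- Otherwise the constant sequence one would tend to zero. Nontriviality makes limits in
probability unique, which `Psi_groupSpecific` uses to identify an entry of `SPhi`. -/
instance probFilter_neBot [IsProbabilityMeasure μ] : (probFilter μ).NeBot := by
  refine ⟨fun h => ?_⟩
  have h0 : ∀ᶠ _x in probFilter μ, False := by rw [h]; exact eventually_bot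
  rw [eventually_probFilter] at h0
  simp only [not_false_eq_true, Set.ofPred_true, measure_univ] at h0
  exact one_ne_zero (tendsto_nhds_unique tendsto_const_nhds h0)

theorem tendstoInMeasure_const_iff {f : ℕ → Ω → ℝ} {c : ℝ} :
    TendstoInMeasure μ f atTop (fun _ => c) ↔
      Tendsto (fun x : ℕ × Ω => f x.1 x.2) (probFilter μ) (𝓝 c) := by
  rw [tendstoInMeasure_iff_dist, Metric.tendsto_nhds]
  refine forall₂_congr fun ε _ => ?_
  rw [eventually_probFilter]
  simp only [not_lt]

/-- Markov's inequality: a nonnegative sequence bounded in mean is `O_P(1)`, and a vanishing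
deterministic factor makes it `o_P(1)`. -/
theorem tendsto_mul_probFilter_of_meanLe {Y : ℕ → Ω → ℝ} {C : ℝ} {a : ℕ → ℝ}
    (hY : ∀ n, MeanLe μ (Y n) C) (hY0 : ∀ n ω, 0 ≤ Y n ω) (ha : Tendsto a atTop (𝓝 0)) :
    Tendsto (fun x : ℕ × Ω => a x.1 * Y x.1 x.2) (probFilter μ) (𝓝 0) := by
  rw [← tendstoInMeasure_const_iff (f := fun n ω => a n * Y n ω), tendstoInMeasure_iff_norm]
  intro ε hε
  have hC : 0 ≤ C := (integral_nonneg (hY0 0)).trans (hY 0).2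
  have hlim : Tendsto (fun n => ENNReal.ofReal (ε⁻¹ * (|a n| * C))) atTop (𝓝 0) := by
    have h : Tendsto (fun n => ε⁻¹ * (|a n| * C)) atTop (𝓝 (ε⁻¹ * (|0| * C))) :=
      (ha.abs.mul_const C).const_mul _
    simpa using ENNReal.tendsto_ofReal h
  refine tendsto_of_tendsto_of_tendsto_of_le_of_le tendsto_const_nhds hlim (fun _ => zero_le) ?_
  intro n
  have hint : Integrable (fun ω => |a n| * Y n ω) μ := (hY n).1.const_mul _
  have hset : {ω | ε ≤ ‖a n * Y n ω - 0‖} = {ω | ENNReal.ofReal ε ≤ ENNReal.ofReal (|a n| * Y n ω)} := by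
    ext ω
    have h0 : 0 ≤ |a n| * Y n ω := mul_nonneg (abs_nonneg _) (hY0 n ω)
    simp only [Set.mem_ofPred_eq, sub_zero, Real.norm_eq_abs, abs_mul, abs_of_nonneg (hY0 n ω)]
    rw [ENNReal.ofReal_le_ofReal_iff h0]
  have hm := meas_ge_le_lintegral_div (μ := μ) (f := fun ω => ENNReal.ofReal (|a n| * Y n ω))
    hint.aemeasurable.ennreal_ofReal (ε := ENNReal.ofReal ε)
    (by simpa using hε) ENNReal.ofReal_ne_top
  change μ {ω | ε ≤ ‖a n * Y n ω - 0‖} ≤ _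
  rw [hset]
  refine hm.trans ?_
  rw [← ofReal_integral_eq_lintegral_ofReal hint
    (ae_of_all _ fun ω => mul_nonneg (abs_nonneg _) (hY0 n ω)),
    ← ENNReal.ofReal_div_of_pos hε, integral_const_mul, div_eq_inv_mul]
  refine ENNReal.ofReal_le_ofReal ?_
  have := (hY n).2
  gcongr

end

/-- Compactness of an interval. Along an ultrafilter boundedness already gives a limit, so no
subsequence has to be chosen. -/
theorem exists_tendsto_of_sq_le {α : Type*} (U : Ultrafilter α) {f : α → ℝ} {B : ℝ}
    (h : ∀ᶠ a in (U : Filter α), f a ^ 2 ≤ B) : ∃ x, Tendsto f U (𝓝 x) := by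
  have hK : IsCompact (Set.Icc (-Real.sqrt B) (Real.sqrt B)) := isCompact_Icc
  obtain ⟨x, -, hx⟩ := hK.ultrafilter_le_nhds (U.map f) (by
    rw [le_principal_iff]
    change ∀ᶠ a in (U : Filter α), f a ∈ Set.Icc (-Real.sqrt B) (Real.sqrt B)
    filter_upwards [h] with a ha
    exact abs_le.1 (Real.abs_le_sqrt ha))
  exact ⟨x, hx⟩

/-! ### Frobenius norm -/

section Frobenius

variable {ι κ l : Type*} [Fintype ι] [Fintype κ] [Fintype l]

theorem sqFrob_nonneg (M : Matrix ι κ ℝ) : 0 ≤ sqFrob M :=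
  Finset.sum_nonneg fun _ _ => Finset.sum_nonneg fun _ _ => sq_nonneg _

theorem sq_entry_le_sqFrob (M : Matrix ι κ ℝ) (i : ι) (j : κ) : M i j ^ 2 ≤ sqFrob M :=
  (Finset.single_le_sum (f := fun j => M i j ^ 2) (fun _ _ => sq_nonneg _)
    (Finset.mem_univ j)).trans
    (Finset.single_le_sum (f := fun i => ∑ j, M i j ^ 2)
      (fun _ _ => Finset.sum_nonneg fun _ _ => sq_nonneg _) (Finset.mem_univ i))

theorem sqFrob_transpose (M : Matrix ι κ ℝ) : sqFrob Mᵀ = sqFrob M := Finset.sum_comm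

theorem sqFrob_smul (c : ℝ) (M : Matrix ι κ ℝ) : sqFrob (c • M) = c ^ 2 * sqFrob M := by
  simp only [sqFrob, Matrix.smul_apply, smul_eq_mul, mul_pow, Finset.mul_sum]

theorem sqFrob_mul_le (A : Matrix ι κ ℝ) (B : Matrix κ l ℝ) :
    sqFrob (A * B) ≤ sqFrob A * sqFrob B := by
  have h : ∀ i j, (A * B) i j ^ 2 ≤ (∑ k, A i k ^ 2) * ∑ k, B k j ^ 2 := fun i j =>
    Finset.sum_mul_sq_le_sq_mul_sq _ _ _
  refine (Finset.sum_le_sum fun i _ => Finset.sum_le_sum fun j _ => h i j).trans ?_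
  simp only [← Finset.mul_sum, ← Finset.sum_mul]
  rw [sqFrob, sqFrob, Finset.sum_comm (f := fun j k => B k j ^ 2)]

theorem sqFrob_add_three_le (A B D : Matrix ι κ ℝ) :
    sqFrob (A + B + D) ≤ 3 * (sqFrob A + sqFrob B + sqFrob D) := by
  simp only [sqFrob, ← Finset.sum_add_distrib, Finset.mul_sum, Matrix.add_apply]
  refine Finset.sum_le_sum fun i _ => Finset.sum_le_sum fun j _ => ?_
  nlinarith [sq_nonneg (A i j - B i j), sq_nonneg (A i j - D i j), sq_nonneg (B i j - D i j)]

theorem sqFrob_eq_trace (M : Matrix ι κ ℝ) : sqFrob M = (Mᵀ * M).trace := by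
  simp only [sqFrob, Matrix.trace, Matrix.diag, Matrix.mul_apply, Matrix.transpose_apply]
  rw [Finset.sum_comm]
  simp only [sq]

/-- Cyclicity of the trace. It exchanges the `N × N` matrix `e eᵀ` for the `T × T` matrix `eᵀ e`,
whose entries are the cross-sectional sums that the moment hypotheses control. -/
theorem sqFrob_mul_transpose (M : Matrix ι κ ℝ) : sqFrob (M * Mᵀ) = sqFrob (Mᵀ * M) := by
  simp only [sqFrob_eq_trace, Matrix.transpose_mul, Matrix.transpose_transpose]
  rw [Matrix.mul_assoc, Matrix.trace_mul_comm]
  simp only [Matrix.mul_assoc]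

theorem sq_dotProduct_mulVec_le (E : Matrix ι ι ℝ) (w : ι → ℝ) :
    (w ⬝ᵥ (E *ᵥ w)) ^ 2 ≤ sqFrob E * (w ⬝ᵥ w) ^ 2 := by
  have h1 : (w ⬝ᵥ (E *ᵥ w)) ^ 2 ≤ (∑ i, w i ^ 2) * ∑ i, (E *ᵥ w) i ^ 2 :=
    Finset.sum_mul_sq_le_sq_mul_sq _ _ _
  have h2 : ∑ i, (E *ᵥ w) i ^ 2 ≤ sqFrob E * ∑ i, w i ^ 2 := by
    rw [sqFrob, Finset.sum_mul]
    exact Finset.sum_le_sum fun i _ => Finset.sum_mul_sq_le_sq_mul_sq _ _ _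
  have h3 : w ⬝ᵥ w = ∑ i, w i ^ 2 := by simp only [dotProduct, sq]
  rw [h3]
  have h4 : 0 ≤ ∑ i, w i ^ 2 := Finset.sum_nonneg fun _ _ => sq_nonneg _
  nlinarith [mul_le_mul_of_nonneg_left h2 h4]

end Frobenius

/-! ### Uniqueness of the limit rotation -/

section Rotation

variable {r : ℕ}

theorem IsLimitRotation.isUnit_det {SF SL H : Matrix (Fin r) (Fin r) ℝ}
    (hH : IsLimitRotation SF SL H) (hSL : SL.PosDef) : IsUnit H.det := by
  have h := hSL.det_pos
  rw [← hH.1, Matrix.det_mul, Matrix.det_transpose] at h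
  exact isUnit_iff_ne_zero.2 fun h0 => by simp [h0] at h

/-- With `SL = H Hᵀ`, the products `SF H Hᵀ` and `Hᵀ SF H` have the same characteristic polynomial,
so the diagonal `d` lists the eigenvalues of `SF * SL`. -/
theorem IsLimitRotation.roots {SF SL H : Matrix (Fin r) (Fin r) ℝ}
    (hH : IsLimitRotation SF SL H) {d : Fin r → ℝ} (hd : Hᵀ * SF * H = Matrix.diagonal d) :
    ((SF * SL).charpoly.map (algebraMap ℝ ℂ)).roots =
      (Finset.univ.val.map d).map (algebraMap ℝ ℂ) := by
  have h1 : (SF * SL).charpoly = ∏ i, (Polynomial.X - Polynomial.C (d i)) := by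
    rw [← Matrix.charpoly_diagonal, ← hd, ← hH.1, ← Matrix.mul_assoc, Matrix.charpoly_mul_comm,
      Matrix.mul_assoc]
  rw [h1, Polynomial.map_prod]
  simp only [Polynomial.map_sub, Polynomial.map_X, Polynomial.map_C]
  rw [Polynomial.roots_prod _ _ (Finset.prod_ne_zero_iff.2 fun i _ => Polynomial.X_sub_C_ne_zero _)]
  simp only [Polynomial.roots_X_sub_C, Multiset.bind_singleton, Multiset.map_map,
    Function.comp_def]

/-- Both rotations diagonalize to the same decreasing list of eigenvalues. Hence `O = H⁻¹ P` is
orthogonal and commutes with a diagonal matrix with distinct entries, so it is diagonal with entries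
`±1`. -/
theorem IsLimitRotation.eq_mul_diagonal {SF SL H P : Matrix (Fin r) (Fin r) ℝ}
    (hSL : SL.PosDef) (hdist : DistinctEigenvalues (SF * SL))
    (hH : IsLimitRotation SF SL H) (hP : IsLimitRotation SF SL P) :
    ∃ s : Fin r → ℝ, (∀ a, s a ^ 2 = 1) ∧ P = H * Matrix.diagonal s := by
  have hHu := hH.isUnit_det hSL
  obtain ⟨d, hda, hd⟩ := hH.2
  obtain ⟨d', hda', hd'⟩ := hP.2
  have hr := hH.roots hd
  have hr' := hP.roots hd'
  have hinj : Function.Injective (algebraMap ℝ ℂ) := (algebraMap ℝ ℂ).injective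
  have hmul : Finset.univ.val.map d = Finset.univ.val.map d' :=
    Multiset.map_injective hinj (hr.symm.trans hr')
  have hnd : (Finset.univ.val.map d).Nodup := by
    have h := hdist
    rw [DistinctEigenvalues, hr] at h
    exact h.of_map _
  have hdi : Function.Injective d := fun a b h =>
    Multiset.inj_on_of_nodup_map hnd a (Finset.mem_univ a) b (Finset.mem_univ b) h
  have hdi' : Function.Injective d' := fun a b h =>
    Multiset.inj_on_of_nodup_map (hmul ▸ hnd) a (Finset.mem_univ a) b (Finset.mem_univ b) h
  -- Equal multisets without repetition give equal ranges, and a strictly decreasing enumeration is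
  -- determined by its range.
  have hdd : d = d' := by
    refine ((hda.strictAnti_of_injective hdi).range_inj
      (hda'.strictAnti_of_injective hdi')).1 ?_
    ext x
    have h : x ∈ Finset.univ.val.map d ↔ x ∈ Finset.univ.val.map d' := by rw [hmul]
    simpa [Multiset.mem_map] using h
  subst hdd
  obtain ⟨O, hO⟩ : ∃ O, O = H⁻¹ * P := ⟨_, rfl⟩
  have hPO : P = H * O := by
    rw [hO, ← Matrix.mul_assoc, Matrix.mul_nonsing_inv _ hHu, Matrix.one_mul]
  have hOO : O * Oᵀ = 1 := by
    have hHt : IsUnit Hᵀ.det := by rwa [Matrix.det_transpose]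
    calc O * Oᵀ = H⁻¹ * (P * Pᵀ) * (H⁻¹)ᵀ := by
          rw [hO, Matrix.transpose_mul]; simp only [Matrix.mul_assoc]
      _ = (H⁻¹ * H) * (Hᵀ * (Hᵀ)⁻¹) := by
          rw [hP.1, ← hH.1, Matrix.transpose_nonsing_inv]; simp only [Matrix.mul_assoc]
      _ = 1 := by
          rw [Matrix.nonsing_inv_mul _ hHu, Matrix.mul_nonsing_inv _ hHt, Matrix.one_mul]
  have hcomm : Matrix.diagonal d * O = O * Matrix.diagonal d := by
    have h : Oᵀ * Matrix.diagonal d * O = Matrix.diagonal d := by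
      have h' := hd'
      rw [hPO, Matrix.transpose_mul] at h'
      calc Oᵀ * Matrix.diagonal d * O = Oᵀ * (Hᵀ * SF * H) * O := by rw [hd]
        _ = Oᵀ * Hᵀ * SF * (H * O) := by simp only [Matrix.mul_assoc]
        _ = Matrix.diagonal d := h'
    calc Matrix.diagonal d * O = (O * Oᵀ) * Matrix.diagonal d * O := by rw [hOO, Matrix.one_mul]
      _ = O * (Oᵀ * Matrix.diagonal d * O) := by simp only [Matrix.mul_assoc]
      _ = O * Matrix.diagonal d := by rw [h]
  have hoff : ∀ a b, a ≠ b → O a b = 0 := by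
    intro a b hab
    have h := congrFun (congrFun hcomm a) b
    rw [Matrix.diagonal_mul, Matrix.mul_diagonal] at h
    have h2 : (d a - d b) * O a b = 0 := by linear_combination h
    exact (mul_eq_zero.1 h2).resolve_left (sub_ne_zero.2 (hdi.ne hab))
  have hOd : O = Matrix.diagonal fun a => O a a := by
    ext a b
    by_cases hab : a = b
    · subst hab; simp
    · rw [Matrix.diagonal_apply_ne _ hab, hoff a b hab]
  refine ⟨fun a => O a a, fun a => ?_, by rw [← hOd]; exact hPO⟩
  have h := congrFun (congrFun hOO a) a
  rw [hOd, Matrix.diagonal_transpose, Matrix.diagonal_mul_diagonal] at h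
  simpa [sq] using h

end Rotation

/-! ### Sign changes of the estimated factors -/

section Signs

variable {N S r : ℕ}

theorem groupMoment_apply (grp : Fin N → Fin S) (L : Matrix (Fin N) (Fin r) ℝ) (j : Fin S)
    (a b : Fin r) : groupMoment grp L j a b =
      1 / (groupSize grp j : ℝ) * ∑ i, groupInd grp j i * (L i a * L i b) := by
  simp only [groupMoment, Matrix.smul_apply, Matrix.sum_apply, Matrix.vecMulVec_apply, smul_eq_mul,
    groupInd, ite_mul, one_mul, zero_mul]
  rw [Finset.sum_filter]

theorem statS_apply (grp : Fin N → Fin S) (j k : Fin S) (L : Matrix (Fin N) (Fin r) ℝ)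
    (p q : VechIdx r) : statS grp j k L p q =
      ((N : ℝ) / groupSize grp j + (N : ℝ) / groupSize grp k) * (1 / (N : ℝ) * ∑ i,
        (L i p.1.1 * L i p.1.2 - (1 : Matrix (Fin r) (Fin r) ℝ) p.1.1 p.1.2) *
        (L i q.1.1 * L i q.1.2 - (1 : Matrix (Fin r) (Fin r) ℝ) q.1.1 q.1.2)) := by
  simp only [statS, Matrix.smul_apply, Matrix.sum_apply, Matrix.vecMulVec_apply, smul_eq_mul,
    vech, Matrix.sub_apply]

/-- Flipping columns multiplies `statA` by a diagonal matrix of signs and conjugates `statS` by the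
same matrix. That matrix is an involution, so it cancels in the quadratic form. -/
theorem statLM_mul_signs (grp : Fin N → Fin S) (j k : Fin S) (L : Matrix (Fin N) (Fin r) ℝ)
    {s : Fin r → ℝ} (hs : ∀ a, s a ^ 2 = 1) :
    statLM grp j k (L * Matrix.diagonal s) = statLM grp j k L := by
  set t : VechIdx r → ℝ := fun p => s p.1.1 * s p.1.2 with ht
  have htt : Matrix.diagonal t * Matrix.diagonal t = 1 := by
    rw [Matrix.diagonal_mul_diagonal, ← Matrix.diagonal_one]
    congr 1; ext p
    linear_combination (s p.1.2) ^ 2 * hs p.1.1 + hs p.1.2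
  have hA : statA grp j k (L * Matrix.diagonal s) = Matrix.diagonal t *ᵥ statA grp j k L := by
    ext p
    rw [Matrix.mulVec_diagonal]
    simp only [statA, vech, Matrix.smul_apply, Matrix.sub_apply, groupMoment_apply,
      Matrix.mul_diagonal, smul_eq_mul, ht]
    have h : ∀ m, ∑ i, groupInd grp m i * (L i p.1.1 * s p.1.1 * (L i p.1.2 * s p.1.2)) =
        s p.1.1 * s p.1.2 * ∑ i, groupInd grp m i * (L i p.1.1 * L i p.1.2) := fun m => by
      rw [Finset.mul_sum]; exact Finset.sum_congr rfl fun i _ => by ring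
    rw [h, h]; ring
  -- The centering by the identity is compatible with the signs: where its entry is nonzero, the
  -- sign is a square and equals one.
  have h1 : ∀ p : VechIdx r, (1 : Matrix (Fin r) (Fin r) ℝ) p.1.1 p.1.2 =
      t p * (1 : Matrix (Fin r) (Fin r) ℝ) p.1.1 p.1.2 := by
    intro p
    by_cases hp : p.1.1 = p.1.2
    · simp only [ht, hp, ← sq, hs, one_mul]
    · simp [Matrix.one_apply_ne hp]
  have hS : statS grp j k (L * Matrix.diagonal s) =
      Matrix.diagonal t * statS grp j k L * Matrix.diagonal t := by
    ext p q
    rw [Matrix.mul_diagonal, Matrix.diagonal_mul]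
    simp only [statS_apply, Matrix.mul_diagonal]
    have h : ∀ i (p : VechIdx r), L i p.1.1 * s p.1.1 * (L i p.1.2 * s p.1.2) -
        (1 : Matrix (Fin r) (Fin r) ℝ) p.1.1 p.1.2 =
        t p * (L i p.1.1 * L i p.1.2 - (1 : Matrix (Fin r) (Fin r) ℝ) p.1.1 p.1.2) := by
      intro i p
      rw [mul_sub, ← h1 p]; ring
    simp only [h, mul_mul_mul_comm (t p) _ (t q)]
    rw [← Finset.mul_sum]
    ring
  rw [statLM, statLM, hA, hS, Matrix.mul_inv_rev, Matrix.mul_inv_rev, Matrix.inv_eq_right_inv htt,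
    Matrix.mulVec_mulVec, Matrix.mul_assoc, Matrix.mul_assoc, htt, Matrix.mul_one,
    ← Matrix.mulVec_mulVec, Matrix.dotProduct_mulVec, ← Matrix.mulVec_transpose,
    Matrix.diagonal_transpose, Matrix.mulVec_mulVec, htt, Matrix.one_mulVec]

end Signs

/-! ### Limits of matrix operations along a filter -/

section Matrices

variable {α : Type*} {F : Filter α} {r : ℕ}

theorem tendsto_matrix_iff {m n : Type*} {M : α → Matrix m n ℝ} {L : Matrix m n ℝ} :
    Tendsto M F (𝓝 L) ↔ ∀ a b, Tendsto (fun x => M x a b) F (𝓝 (L a b)) :=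
  tendsto_pi_nhds.trans (forall_congr' fun _ => tendsto_pi_nhds)

theorem tendsto_transpose {M : α → Matrix (Fin r) (Fin r) ℝ} {L : Matrix (Fin r) (Fin r) ℝ}
    (h : Tendsto M F (𝓝 L)) : Tendsto (fun x => (M x)ᵀ) F (𝓝 Lᵀ) :=
  tendsto_matrix_iff.2 fun a b => tendsto_matrix_iff.1 h b a

theorem tendsto_diagonal {d : α → Fin r → ℝ} {v : Fin r → ℝ}
    (h : ∀ a, Tendsto (fun x => d x a) F (𝓝 (v a))) :
    Tendsto (fun x => Matrix.diagonal (d x)) F (𝓝 (Matrix.diagonal v)) :=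
  (Continuous.matrix_diagonal continuous_id).continuousAt.tendsto.comp (tendsto_pi_nhds.2 h)

theorem tendsto_mulVec {m n : Type*} [Fintype n] {M : α → Matrix m n ℝ} {L : Matrix m n ℝ} {u : α → n → ℝ}
    {v : n → ℝ} (h : Tendsto M F (𝓝 L)) (hu : Tendsto u F (𝓝 v)) :
    Tendsto (fun x => M x *ᵥ u x) F (𝓝 (L *ᵥ v)) :=
  (Continuous.matrix_mulVec continuous_fst continuous_snd).continuousAt.tendsto.comp
    (h.prodMk_nhds hu)

theorem tendsto_dotProduct {n : Type*} [Fintype n] {w u : α → n → ℝ} {v z : n → ℝ}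
    (hw : Tendsto w F (𝓝 z)) (hu : Tendsto u F (𝓝 v)) :
    Tendsto (fun x => w x ⬝ᵥ u x) F (𝓝 (z ⬝ᵥ v)) :=
  (Continuous.dotProduct continuous_fst continuous_snd).continuousAt.tendsto.comp
    (hw.prodMk_nhds hu)

/-- The inverse is the adjugate divided by the determinant, so only the limit has to be invertible.
-/
theorem tendsto_matrix_inv {n : Type*} [Fintype n] [DecidableEq n] {M : α → Matrix n n ℝ}
    {L : Matrix n n ℝ} (h : Tendsto M F (𝓝 L)) (hL : IsUnit L.det) :
    Tendsto (fun x => (M x)⁻¹) F (𝓝 L⁻¹) := by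
  have hdet : Tendsto (fun x => (M x).det) F (𝓝 L.det) :=
    (Continuous.matrix_det continuous_id).continuousAt.tendsto.comp h
  have hadj : Tendsto (fun x => (M x).adjugate) F (𝓝 L.adjugate) :=
    (Continuous.matrix_adjugate continuous_id).continuousAt.tendsto.comp h
  simp only [Matrix.inv_def, Ring.inverse_eq_inv']
  exact (hdet.inv₀ hL.ne_zero).smul hadj

theorem tendsto_of_sqFrob {m n : Type*} [Fintype m] [Fintype n] {M : α → Matrix m n ℝ}
    (h : Tendsto (fun x => sqFrob (M x)) F (𝓝 0)) : Tendsto M F (𝓝 0) := by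
  refine tendsto_matrix_iff.2 fun a b => ?_
  have h1 : Tendsto (fun x => (M x a b) ^ 2) F (𝓝 0) :=
    tendsto_of_tendsto_of_tendsto_of_le_of_le tendsto_const_nhds h (fun _ => sq_nonneg _)
      (fun x => sq_entry_le_sqFrob (M x) a b)
  have h2 := h1.sqrt
  simp only [Real.sqrt_sq_eq_abs, Real.sqrt_zero] at h2
  exact (tendsto_zero_iff_abs_tendsto_zero _).2 h2

end Matrices

/-! ### The limit of the principal components -/

section PrincipalComponents

variable {α : Type*} {U : Ultrafilter α} {r : ℕ} {N : α → ℕ}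
  {Φ L : (x : α) → Matrix (Fin (N x)) (Fin r) ℝ}
  {Y E : (x : α) → Matrix (Fin (N x)) (Fin (N x)) ℝ} {A : α → Matrix (Fin r) (Fin r) ℝ}
  {d : α → Fin r → ℝ} {SG SPhi : Matrix (Fin r) (Fin r) ℝ}

theorem sqFrob_of_transpose_mul_self {n r : ℕ} {L : Matrix (Fin n) (Fin r) ℝ}
    (hL : Lᵀ * L = (n : ℝ) • (1 : Matrix (Fin r) (Fin r) ℝ)) : sqFrob L = n * r := by
  rw [sqFrob_eq_trace, hL, Matrix.trace_smul, Matrix.trace_one]; simp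

/-- The outer factors have Frobenius norm of order `√N` each, which the factor `1 / N` exactly
absorbs. -/
theorem tendsto_normalized_cross {N : α → ℕ} {F : Filter α}
    {W Z : (x : α) → Matrix (Fin (N x)) (Fin r) ℝ} {E : (x : α) → Matrix (Fin (N x)) (Fin (N x)) ℝ}
    {b c : ℝ} (hW : ∀ᶠ x in F, sqFrob (W x) ≤ N x * b) (hZ : ∀ᶠ x in F, sqFrob (Z x) ≤ N x * c)
    (hN : ∀ᶠ x in F, 0 < N x) (hE : Tendsto (fun x => sqFrob (E x)) F (𝓝 0)) :
    Tendsto (fun x => (N x : ℝ)⁻¹ • ((W x)ᵀ * E x * Z x)) F (𝓝 0) := by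
  refine tendsto_of_sqFrob ?_
  have h0 : Tendsto (fun x => b * c * sqFrob (E x)) F (𝓝 0) := by simpa using hE.const_mul (b * c)
  refine tendsto_of_tendsto_of_tendsto_of_le_of_le' tendsto_const_nhds h0
    (Eventually.of_forall fun _ => sqFrob_nonneg _) ?_
  filter_upwards [hW, hZ, hN] with x h1 h2 h3
  have h3' : (0 : ℝ) < N x := by exact_mod_cast h3
  rw [sqFrob_smul]
  calc ((N x : ℝ)⁻¹) ^ 2 * sqFrob ((W x)ᵀ * E x * Z x)
      ≤ ((N x : ℝ)⁻¹) ^ 2 * ((N x * b) * sqFrob (E x) * (N x * c)) := by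
        refine mul_le_mul_of_nonneg_left ?_ (sq_nonneg _)
        refine (sqFrob_mul_le _ _).trans ?_
        have hE0 := sqFrob_nonneg (E x)
        have hW0 := sqFrob_nonneg (W x)
        refine mul_le_mul ((sqFrob_mul_le _ _).trans ?_) h2 (sqFrob_nonneg _) ?_
        · rw [sqFrob_transpose]; gcongr
        · exact mul_nonneg (hW0.trans h1) hE0
    _ = b * c * sqFrob (E x) := by field_simp

/-- Multiply `Y L = L D` on the left by `Lᵀ / N` and by `Φᵀ / N`. In the limit `Pᵀ SG P` is diagonal
and `SPhi SG P = P (Pᵀ SG P)`. If `P` is invertible, cancelling `SG P` gives `P Pᵀ = SPhi`, so `P`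
is a limit rotation. Singular limits are excluded because the eigenvalues are the largest ones. -/
theorem exists_pc_limit (hN : ∀ᶠ x in (U : Filter α), 0 < N x)
    (hA : Tendsto A U (𝓝 SG)) (hSG : SG.PosDef)
    (hB : Tendsto (fun x => (N x : ℝ)⁻¹ • ((Φ x)ᵀ * Φ x)) U (𝓝 SPhi)) (hSPhi : SPhi.PosDef)
    (hE : Tendsto (fun x => sqFrob (E x)) U (𝓝 0))
    (hY : ∀ᶠ x in (U : Filter α), Y x = (N x : ℝ)⁻¹ • (Φ x * A x * (Φ x)ᵀ) + E x)
    (hLL : ∀ᶠ x in (U : Filter α), (L x)ᵀ * L x = (N x : ℝ) • (1 : Matrix (Fin r) (Fin r) ℝ))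
    (hd : ∀ᶠ x in (U : Filter α), Antitone (d x))
    (hYL : ∀ᶠ x in (U : Filter α), Y x * L x = L x * Matrix.diagonal (d x))
    (hmax : ∀ᶠ x in (U : Filter α), ∀ w : Fin (N x) → ℝ, (L x)ᵀ *ᵥ w = 0 →
      ∀ l, w ⬝ᵥ (Y x *ᵥ w) ≤ d x l * (w ⬝ᵥ w)) :
    ∃ (P : Matrix (Fin r) (Fin r) ℝ) (v : Fin r → ℝ), IsLimitRotation SG SPhi P ∧
      Tendsto (fun x => (N x : ℝ)⁻¹ • ((Φ x)ᵀ * L x)) U (𝓝 P) ∧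
      (∀ l, Tendsto (fun x => d x l) U (𝓝 (v l))) ∧ Pᵀ * SG * P = Matrix.diagonal v ∧
      ∀ l, 0 < v l := by
  -- size of the loadings
  have hΦ : ∀ᶠ x in (U : Filter α), sqFrob (Φ x) ≤ N x * (SPhi.trace + 1) := by
    have h1 : Tendsto (fun x => ((N x : ℝ)⁻¹ • ((Φ x)ᵀ * Φ x)).trace) U (𝓝 SPhi.trace) :=
      (Continuous.matrix_trace continuous_id).continuousAt.tendsto.comp hB
    filter_upwards [hN, h1.eventually_lt_const (lt_add_one _)] with x hx h2
    have hx' : (0 : ℝ) < N x := by exact_mod_cast hx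
    rw [Matrix.trace_smul, ← sqFrob_eq_trace, smul_eq_mul, inv_mul_lt_iff₀ hx'] at h2
    exact h2.le
  have hL : ∀ᶠ x in (U : Filter α), sqFrob (L x) ≤ N x * r := by
    filter_upwards [hLL] with x hx
    exact (sqFrob_of_transpose_mul_self hx).le
  have hLEL := tendsto_normalized_cross hL hL hN hE
  have hΦEL := tendsto_normalized_cross hΦ hL hN hE
  -- the cross moment converges along the ultrafilter
  obtain ⟨P, hP⟩ : ∃ P : Matrix (Fin r) (Fin r) ℝ,
      Tendsto (fun x => (N x : ℝ)⁻¹ • ((Φ x)ᵀ * L x)) U (𝓝 P) := by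
    have h : ∀ a b, ∃ y, Tendsto (fun x => ((N x : ℝ)⁻¹ • ((Φ x)ᵀ * L x)) a b) U (𝓝 y) := by
      intro a b
      refine exists_tendsto_of_sq_le U (B := (SPhi.trace + 1) * r) ?_
      filter_upwards [hN, hΦ, hL] with x hx h1 h2
      have hx' : (0 : ℝ) < N x := by exact_mod_cast hx
      refine (sq_entry_le_sqFrob _ _ _).trans ?_
      rw [sqFrob_smul]
      calc ((N x : ℝ)⁻¹) ^ 2 * sqFrob ((Φ x)ᵀ * L x)
          ≤ ((N x : ℝ)⁻¹) ^ 2 * ((N x * (SPhi.trace + 1)) * (N x * r)) := by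
            refine mul_le_mul_of_nonneg_left ((sqFrob_mul_le _ _).trans ?_) (sq_nonneg _)
            rw [sqFrob_transpose]
            exact mul_le_mul h1 h2 (sqFrob_nonneg _) ((sqFrob_nonneg _).trans h1)
        _ = (SPhi.trace + 1) * r := by field_simp
    choose P hP using h
    exact ⟨Matrix.of P, tendsto_matrix_iff.2 hP⟩
  have hPt := tendsto_transpose hP
  -- the eigenvector equation multiplied by the estimated and the true loadings
  have hdeq : ∀ᶠ x in (U : Filter α), ((N x : ℝ)⁻¹ • ((Φ x)ᵀ * L x))ᵀ * A x *
      ((N x : ℝ)⁻¹ • ((Φ x)ᵀ * L x)) + (N x : ℝ)⁻¹ • ((L x)ᵀ * E x * L x) =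
      Matrix.diagonal (d x) := by
    filter_upwards [hN, hY, hLL, hYL] with x hx h1 h2 h3
    have hx' : (N x : ℝ) ≠ 0 := by exact_mod_cast hx.ne'
    have h4 : (N x : ℝ)⁻¹ • ((L x)ᵀ * (Y x * L x)) = Matrix.diagonal (d x) := by
      rw [h3, ← Matrix.mul_assoc, h2, Matrix.smul_mul, smul_smul, inv_mul_cancel₀ hx', one_smul,
        Matrix.one_mul]
    rw [← h4, h1]
    simp only [Matrix.transpose_smul, Matrix.transpose_mul, Matrix.transpose_transpose,
      Matrix.add_mul, Matrix.mul_add, Matrix.smul_mul, Matrix.mul_smul, smul_add, smul_smul,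
      Matrix.mul_assoc]
  have hPeq : ∀ᶠ x in (U : Filter α), ((N x : ℝ)⁻¹ • ((Φ x)ᵀ * Φ x)) * A x *
      ((N x : ℝ)⁻¹ • ((Φ x)ᵀ * L x)) + (N x : ℝ)⁻¹ • ((Φ x)ᵀ * E x * L x) =
      ((N x : ℝ)⁻¹ • ((Φ x)ᵀ * L x)) * Matrix.diagonal (d x) := by
    filter_upwards [hY, hYL] with x h1 h3
    have h4 : (N x : ℝ)⁻¹ • ((Φ x)ᵀ * (Y x * L x)) =
        ((N x : ℝ)⁻¹ • ((Φ x)ᵀ * L x)) * Matrix.diagonal (d x) := by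
      rw [h3, ← Matrix.mul_assoc, Matrix.smul_mul]
    rw [← h4, h1]
    simp only [Matrix.add_mul, Matrix.mul_add, Matrix.smul_mul, Matrix.mul_smul, smul_add,
      smul_smul, Matrix.mul_assoc]
  have hdlim : Tendsto (fun x => Matrix.diagonal (d x)) U (𝓝 (Pᵀ * SG * P)) := by
    have h := ((hPt.mul hA).mul hP).add hLEL
    rw [add_zero] at h
    exact h.congr' hdeq
  obtain ⟨v, hv⟩ : ∃ v : Fin r → ℝ, v = fun l => (Pᵀ * SG * P) l l := ⟨_, rfl⟩
  have hdv : ∀ l, Tendsto (fun x => d x l) U (𝓝 (v l)) := by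
    intro l
    have h := tendsto_matrix_iff.1 hdlim l l
    simpa [hv] using h
  have hV : Pᵀ * SG * P = Matrix.diagonal v := tendsto_nhds_unique hdlim (tendsto_diagonal hdv)
  have hvanti : Antitone v := fun a b hab =>
    le_of_tendsto_of_tendsto (hdv b) (hdv a) (hd.mono fun x hx => hx hab)
  have hPV : P * Matrix.diagonal v = SPhi * SG * P := by
    have h := ((hB.mul hA).mul hP).add hΦEL
    rw [add_zero] at h
    exact (tendsto_nhds_unique (h.congr' hPeq) (hP.mul (tendsto_diagonal hdv))).symm
  -- the limit is invertible
  have hPdet : P.det ≠ 0 := by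
    intro h0
    have h0' : Pᵀ.det = 0 := by rwa [Matrix.det_transpose]
    obtain ⟨u, hu, hPu⟩ := Matrix.exists_mulVec_eq_zero_iff.2 h0'
    -- For `u ≠ 0` with `Pᵀ u = 0`, the direction `Φ u` is almost orthogonal to the estimated
    -- loadings. Let `w` be its residual after projection on their columns, with coefficients `p →
    -- 0`. Then `w` has squared length of order `N`, and the form of `Y` on it, divided by `N`, has
    -- a positive limit.
    set p : α → Fin r → ℝ := fun x => ((N x : ℝ)⁻¹ • ((Φ x)ᵀ * L x))ᵀ *ᵥ u with hp
    have hp0 : Tendsto p U (𝓝 0) := by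
      have h := tendsto_mulVec hPt (tendsto_const_nhds (x := u))
      rwa [hPu] at h
    set w : (x : α) → Fin (N x) → ℝ := fun x => Φ x *ᵥ u - L x *ᵥ p x with hw
    set q : α → Fin r → ℝ := fun x => ((N x : ℝ)⁻¹ • ((Φ x)ᵀ * Φ x)) *ᵥ u -
      ((N x : ℝ)⁻¹ • ((Φ x)ᵀ * L x)) *ᵥ p x with hq
    have hq0 : Tendsto q U (𝓝 (SPhi *ᵥ u)) := by
      have h := (tendsto_mulVec hB (tendsto_const_nhds (x := u))).sub (tendsto_mulVec hP hp0)
      simpa using h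
    have hLw : ∀ᶠ x in (U : Filter α), (L x)ᵀ *ᵥ w x = 0 := by
      filter_upwards [hN, hLL] with x hx h2
      have hx' : (N x : ℝ) ≠ 0 := by exact_mod_cast hx.ne'
      simp only [hw, hp]
      rw [Matrix.mulVec_sub, Matrix.mulVec_mulVec, Matrix.mulVec_mulVec, h2, Matrix.smul_mulVec,
        Matrix.one_mulVec, Matrix.transpose_smul, Matrix.smul_mulVec, smul_smul,
        mul_inv_cancel₀ hx', one_smul, Matrix.transpose_mul, Matrix.transpose_transpose, sub_self]
    have hΦw : ∀ x, (N x : ℝ)⁻¹ • ((Φ x)ᵀ *ᵥ w x) = q x := by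
      intro x
      simp only [hw, hq]
      rw [Matrix.mulVec_sub, Matrix.mulVec_mulVec, Matrix.mulVec_mulVec, smul_sub,
        Matrix.smul_mulVec, Matrix.smul_mulVec]
    have hww : ∀ᶠ x in (U : Filter α), (N x : ℝ)⁻¹ * (w x ⬝ᵥ w x) = u ⬝ᵥ q x := by
      filter_upwards [hLw] with x hx
      have h1 : w x ⬝ᵥ w x = u ⬝ᵥ ((Φ x)ᵀ *ᵥ w x) := by
        have h2 : L x *ᵥ p x ⬝ᵥ w x = 0 := by
          rw [← Matrix.vecMul_transpose, ← Matrix.dotProduct_mulVec, hx, dotProduct_zero]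
        calc w x ⬝ᵥ w x = Φ x *ᵥ u ⬝ᵥ w x - L x *ᵥ p x ⬝ᵥ w x := sub_dotProduct _ _ _
          _ = u ⬝ᵥ ((Φ x)ᵀ *ᵥ w x) := by
            rw [h2, sub_zero, ← Matrix.vecMul_transpose, ← Matrix.dotProduct_mulVec]
      rw [h1, ← hΦw, dotProduct_smul, smul_eq_mul]
    have hwlim : Tendsto (fun x => (N x : ℝ)⁻¹ * (w x ⬝ᵥ w x)) U (𝓝 (u ⬝ᵥ (SPhi *ᵥ u))) :=
      (tendsto_dotProduct tendsto_const_nhds hq0).congr' (hww.mono fun _ h => h.symm)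
    have hwE : Tendsto (fun x => (N x : ℝ)⁻¹ * (w x ⬝ᵥ (E x *ᵥ w x))) U (𝓝 0) := by
      have h1 : Tendsto (fun x => sqFrob (E x) * ((N x : ℝ)⁻¹ * (w x ⬝ᵥ w x)) ^ 2) U (𝓝 0) := by
        simpa using hE.mul (hwlim.pow 2)
      have h2 : Tendsto (fun x => ((N x : ℝ)⁻¹ * (w x ⬝ᵥ (E x *ᵥ w x))) ^ 2) U (𝓝 0) := by
        refine tendsto_of_tendsto_of_tendsto_of_le_of_le tendsto_const_nhds h1
          (fun _ => sq_nonneg _) fun x => ?_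
        have h3 := mul_le_mul_of_nonneg_left (sq_dotProduct_mulVec_le (E x) (w x))
          (sq_nonneg ((N x : ℝ)⁻¹))
        calc _ = ((N x : ℝ)⁻¹) ^ 2 * (w x ⬝ᵥ (E x *ᵥ w x)) ^ 2 := by ring
          _ ≤ _ := h3
          _ = _ := by ring
      have h4 := h2.sqrt
      simp only [Real.sqrt_sq_eq_abs, Real.sqrt_zero] at h4
      exact (tendsto_zero_iff_abs_tendsto_zero _).2 h4
    have hwY : ∀ᶠ x in (U : Filter α), (N x : ℝ)⁻¹ * (w x ⬝ᵥ (Y x *ᵥ w x)) =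
        q x ⬝ᵥ (A x *ᵥ q x) + (N x : ℝ)⁻¹ * (w x ⬝ᵥ (E x *ᵥ w x)) := by
      filter_upwards [hY] with x hx
      rw [hx, Matrix.add_mulVec, dotProduct_add, mul_add, ← hΦw, Matrix.mulVec_smul,
        dotProduct_smul, smul_dotProduct, Matrix.smul_mulVec, dotProduct_smul,
        ← Matrix.mulVec_mulVec, ← Matrix.mulVec_mulVec, Matrix.dotProduct_mulVec,
        ← Matrix.mulVec_transpose]
      simp only [smul_eq_mul]
    have hYlim : Tendsto (fun x => (N x : ℝ)⁻¹ * (w x ⬝ᵥ (Y x *ᵥ w x))) U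
        (𝓝 ((SPhi *ᵥ u) ⬝ᵥ (SG *ᵥ (SPhi *ᵥ u)))) := by
      have h := (tendsto_dotProduct hq0 (tendsto_mulVec hA hq0)).add hwE
      rw [add_zero] at h
      exact h.congr' (hwY.mono fun _ h => h.symm)
    have hc : 0 < u ⬝ᵥ (SPhi *ᵥ u) := by simpa using hSPhi.dotProduct_mulVec_pos hu
    have hz : SPhi *ᵥ u ≠ 0 := fun h => by simp [h] at hc
    have hz' : 0 < (SPhi *ᵥ u) ⬝ᵥ (SG *ᵥ (SPhi *ᵥ u)) := by
      simpa using hSG.dotProduct_mulVec_pos hz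
    have hvpos : ∀ l, 0 < v l := by
      intro l
      have h : (SPhi *ᵥ u) ⬝ᵥ (SG *ᵥ (SPhi *ᵥ u)) ≤ v l * (u ⬝ᵥ (SPhi *ᵥ u)) := by
        refine le_of_tendsto_of_tendsto hYlim ((hdv l).mul hwlim) ?_
        filter_upwards [hLw, hmax] with x h1 h2
        have h3 := mul_le_mul_of_nonneg_left (h2 _ h1 l) (inv_nonneg.2 (Nat.cast_nonneg (N x)))
        calc _ ≤ _ := h3
          _ = _ := by ring
      exact pos_of_mul_pos_left (hz'.trans_le h) hc.le
    -- Maximality has made every limiting eigenvalue positive, whereas `det P = 0` forces their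
    -- product to vanish.
    have h1 := congrArg Matrix.det hV
    rw [Matrix.det_mul, h0, mul_zero, Matrix.det_diagonal] at h1
    exact (Finset.prod_pos fun l _ => hvpos l).ne h1
  have hPu : IsUnit P.det := isUnit_iff_ne_zero.2 hPdet
  have hPD : (Pᵀ * SG * P).PosDef := by
    have hinj : Function.Injective P.mulVec := Matrix.mulVec_injective_iff_isUnit.2
      ((Matrix.isUnit_iff_isUnit_det P).2 hPu)
    simpa using hSG.conjTranspose_mul_mul_same hinj
  have hvpos : ∀ l, 0 < v l := by
    intro l
    have h := hPD.diag_pos (i := l)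
    rw [hV] at h
    simpa using h
  have hPP : P * Pᵀ = SPhi := by
    have h : (P * Pᵀ) * (SG * P) = SPhi * (SG * P) := by
      rw [← Matrix.mul_assoc, ← Matrix.mul_assoc, ← hPV, ← hV]
      simp only [Matrix.mul_assoc]
    have hu : IsUnit (SG * P).det := by
      rw [Matrix.det_mul]
      exact (isUnit_iff_ne_zero.2 hSG.det_pos.ne').mul hPu
    have h2 := congrArg (· * (SG * P)⁻¹) h
    simpa only [Matrix.mul_assoc, Matrix.mul_nonsing_inv _ hu, Matrix.mul_one] using h2
  exact ⟨P, v, ⟨hPP, v, hvanti, hV⟩, hP, hdv, hV, hvpos⟩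

end PrincipalComponents

/-! ### Averages over the variables -/

/-- The average of a vector. -/
noncomputable def avg {n : ℕ} (u : Fin n → ℝ) : ℝ := 1 / (n : ℝ) * ∑ i, u i

section Averages

variable {n : ℕ}

theorem avg_mono {u v : Fin n → ℝ} (h : ∀ i, u i ≤ v i) : avg u ≤ avg v :=
  mul_le_mul_of_nonneg_left (Finset.sum_le_sum fun i _ => h i) (by positivity)

theorem avg_nonneg {u : Fin n → ℝ} (h : ∀ i, 0 ≤ u i) : 0 ≤ avg u :=
  mul_nonneg (by positivity) (Finset.sum_nonneg fun i _ => h i)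

theorem avg_add (u v : Fin n → ℝ) : avg (fun i => u i + v i) = avg u + avg v := by
  simp only [avg, Finset.sum_add_distrib, mul_add]

theorem avg_const_mul (c : ℝ) (u : Fin n → ℝ) : avg (fun i => c * u i) = c * avg u := by
  simp only [avg, ← Finset.mul_sum]; ring

theorem avg_sum {κ : Type*} (s : Finset κ) (u : κ → Fin n → ℝ) :
    avg (fun i => ∑ c ∈ s, u c i) = ∑ c ∈ s, avg (u c) := by
  simp only [avg, ← Finset.mul_sum]; rw [Finset.sum_comm]

theorem avg_const_le {c : ℝ} (hc : 0 ≤ c) : avg (fun _ : Fin n => c) ≤ c := by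
  rcases Nat.eq_zero_or_pos n with h | h
  · subst h; simpa [avg] using hc
  · have : (n : ℝ) ≠ 0 := by positivity
    simp [avg, this]

theorem sq_avg_mul_le (u v : Fin n → ℝ) :
    avg (fun i => u i * v i) ^ 2 ≤ avg (fun i => u i ^ 2) * avg (fun i => v i ^ 2) := by
  simp only [avg]
  calc _ = (1 / (n : ℝ)) ^ 2 * (∑ i, u i * v i) ^ 2 := by ring
    _ ≤ (1 / (n : ℝ)) ^ 2 * ((∑ i, u i ^ 2) * ∑ i, v i ^ 2) :=
      mul_le_mul_of_nonneg_left (Finset.sum_mul_sq_le_sq_mul_sq _ _ _) (sq_nonneg _)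
    _ = _ := by ring

variable {α : Type*} {F : Filter α} {N : α → ℕ}

theorem tendsto_zero_of_sq {f : α → ℝ} (h : Tendsto (fun x => f x ^ 2) F (𝓝 0)) :
    Tendsto f F (𝓝 0) := by
  have h2 := h.sqrt
  simp only [Real.sqrt_sq_eq_abs, Real.sqrt_zero] at h2
  exact (tendsto_zero_iff_abs_tendsto_zero _).2 h2

theorem tendsto_avg_mul_zero {u v : (x : α) → Fin (N x) → ℝ} {B : ℝ}
    (hu : Tendsto (fun x => avg fun i => u x i ^ 2) F (𝓝 0))
    (hv : ∀ᶠ x in F, avg (fun i => v x i ^ 2) ≤ B) :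
    Tendsto (fun x => avg fun i => u x i * v x i) F (𝓝 0) := by
  refine tendsto_zero_of_sq ?_
  have h : Tendsto (fun x => (avg fun i => u x i ^ 2) * B) F (𝓝 0) := by simpa using hu.mul_const B
  refine tendsto_of_tendsto_of_tendsto_of_le_of_le' tendsto_const_nhds h
    (Eventually.of_forall fun _ => sq_nonneg _) ?_
  filter_upwards [hv] with x hx
  exact (sq_avg_mul_le _ _).trans
    (mul_le_mul_of_nonneg_left hx (avg_nonneg fun _ => sq_nonneg _))

theorem tendsto_avg_sq_add_zero {u v : (x : α) → Fin (N x) → ℝ}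
    (hu : Tendsto (fun x => avg fun i => u x i ^ 2) F (𝓝 0))
    (hv : Tendsto (fun x => avg fun i => v x i ^ 2) F (𝓝 0)) :
    Tendsto (fun x => avg fun i => (u x i + v x i) ^ 2) F (𝓝 0) := by
  have h : Tendsto (fun x => 2 * (avg (fun i => u x i ^ 2) + avg fun i => v x i ^ 2)) F (𝓝 0) := by
    simpa using (hu.add hv).const_mul 2
  refine tendsto_of_tendsto_of_tendsto_of_le_of_le tendsto_const_nhds h
    (fun _ => avg_nonneg fun _ => sq_nonneg _) fun x => ?_
  rw [← avg_add, ← avg_const_mul]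
  exact avg_mono fun i => by nlinarith [sq_nonneg (u x i - v x i)]

theorem tendsto_avg_pow_four_add_zero {u v : (x : α) → Fin (N x) → ℝ}
    (hu : Tendsto (fun x => avg fun i => u x i ^ 4) F (𝓝 0))
    (hv : Tendsto (fun x => avg fun i => v x i ^ 4) F (𝓝 0)) :
    Tendsto (fun x => avg fun i => (u x i + v x i) ^ 4) F (𝓝 0) := by
  have h : Tendsto (fun x => 8 * (avg (fun i => u x i ^ 4) + avg fun i => v x i ^ 4)) F (𝓝 0) := by
    simpa using (hu.add hv).const_mul 8
  refine tendsto_of_tendsto_of_tendsto_of_le_of_le tendsto_const_nhds h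
    (fun _ => avg_nonneg fun _ => by positivity) fun x => ?_
  rw [← avg_add, ← avg_const_mul]
  refine avg_mono fun i => ?_
  have h1 : (u x i + v x i) ^ 2 ≤ 2 * (u x i ^ 2 + v x i ^ 2) := by
    nlinarith [sq_nonneg (u x i - v x i)]
  have h2 := pow_le_pow_left₀ (sq_nonneg (u x i + v x i)) h1 2
  nlinarith [sq_nonneg (u x i ^ 2 - v x i ^ 2)]

end Averages

/-! ### Estimation error of the loadings in fourth mean -/

section Loadings

variable {α : Type*} {r : ℕ} {N : α → ℕ}

theorem tendsto_avg_pow_four_mul {F : Filter α} {m : (x : α) → Matrix (Fin (N x)) (Fin r) ℝ}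
    {R : α → Matrix (Fin r) (Fin r) ℝ} {B : ℝ}
    (hm : ∀ᶠ x in F, ∀ c, avg (fun i => m x i c ^ 4) ≤ B)
    (hR : Tendsto R F (𝓝 0)) (b : Fin r) :
    Tendsto (fun x => avg fun i => (m x * R x) i b ^ 4) F (𝓝 0) := by
  have hR' : Tendsto (fun x => (r * ∑ _c : Fin r, B) * (∑ c, R x c b ^ 2) ^ 2) F (𝓝 0) := by
    have h1 : Tendsto (fun x => ∑ c, R x c b ^ 2) F (𝓝 (∑ _c : Fin r, (0 : ℝ) ^ 2)) :=
      tendsto_finsetSum _ fun c _ => (tendsto_matrix_iff.1 hR c b).pow 2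
    have h2 : Tendsto (fun x => ∑ c, R x c b ^ 2) F (𝓝 0) := by simpa using h1
    simpa using (h2.pow 2).const_mul (r * ∑ _c : Fin r, B)
  refine tendsto_of_tendsto_of_tendsto_of_le_of_le' tendsto_const_nhds hR'
    (Eventually.of_forall fun _ => avg_nonneg fun _ => by positivity) ?_
  filter_upwards [hm] with x hx
  have h1 : ∀ i, (m x * R x) i b ^ 4 ≤ (∑ c, R x c b ^ 2) ^ 2 * r * ∑ c, m x i c ^ 4 := by
    intro i
    have h2 : (m x * R x) i b ^ 2 ≤ (∑ c, m x i c ^ 2) * ∑ c, R x c b ^ 2 := by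
      rw [Matrix.mul_apply]
      exact Finset.sum_mul_sq_le_sq_mul_sq _ _ _
    have h3 : (∑ c, m x i c ^ 2) ^ 2 ≤ r * ∑ c, (m x i c ^ 2) ^ 2 := by
      simpa using sq_sum_le_card_mul_sum_sq (s := Finset.univ) (f := fun c => m x i c ^ 2)
    calc (m x * R x) i b ^ 4 = ((m x * R x) i b ^ 2) ^ 2 := by ring
      _ ≤ ((∑ c, m x i c ^ 2) * ∑ c, R x c b ^ 2) ^ 2 := pow_le_pow_left₀ (sq_nonneg _) h2 2
      _ = (∑ c, R x c b ^ 2) ^ 2 * (∑ c, m x i c ^ 2) ^ 2 := by ring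
      _ ≤ (∑ c, R x c b ^ 2) ^ 2 * (r * ∑ c, (m x i c ^ 2) ^ 2) :=
        mul_le_mul_of_nonneg_left h3 (sq_nonneg _)
      _ = _ := by simp only [← pow_mul]; ring
  refine (avg_mono h1).trans ?_
  rw [avg_const_mul, avg_sum]
  calc _ ≤ (∑ c, R x c b ^ 2) ^ 2 * r * ∑ _c : Fin r, B := by
        gcongr with c; exact hx c
    _ = _ := by ring

/-- A sum of squares of nonnegative numbers is at most the square of their sum. The bound is crude,
and the factor `√N` in the control of `E` pays for it. -/
theorem avg_pow_four_le {n : ℕ} (hn : 0 < n) (M : Matrix (Fin n) (Fin r) ℝ) (b : Fin r) :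
    avg (fun i => M i b ^ 4) ≤ 1 / (n : ℝ) * sqFrob M ^ 2 := by
  refine mul_le_mul_of_nonneg_left ?_ (by positivity)
  have h1 : ∑ i, M i b ^ 2 ≤ sqFrob M := Finset.sum_le_sum fun i _ =>
    Finset.single_le_sum (f := fun b => M i b ^ 2) (fun _ _ => sq_nonneg _) (Finset.mem_univ b)
  have h2 : ∑ i, (M i b ^ 2) ^ 2 ≤ (∑ i, M i b ^ 2) ^ 2 :=
    Finset.sum_sq_le_sq_sum_of_nonneg fun _ _ => sq_nonneg _
  calc ∑ i, M i b ^ 4 = ∑ i, (M i b ^ 2) ^ 2 := by simp only [← pow_mul]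
    _ ≤ (∑ i, M i b ^ 2) ^ 2 := h2
    _ ≤ _ := pow_le_pow_left₀ (Finset.sum_nonneg fun _ _ => sq_nonneg _) h1 2

variable {U : Ultrafilter α}
  {Φ L : (x : α) → Matrix (Fin (N x)) (Fin r) ℝ}
  {Y E : (x : α) → Matrix (Fin (N x)) (Fin (N x)) ℝ} {A : α → Matrix (Fin r) (Fin r) ℝ}
  {d : α → Fin r → ℝ} {SG SPhi Xi0 : Matrix (Fin r) (Fin r) ℝ}

/-- Inverting the eigenvalues gives `L = Φ (A (Φᵀ L / N) D⁻¹) + E L D⁻¹`. The bracket tends to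
`(Xi0ᵀ)⁻¹` up to the signs `s` relating `P` to `Xi0`, and the last term is small. The signs may
depend on the ultrafilter. -/
theorem exists_signs_tendsto_loadings (hN : ∀ᶠ x in (U : Filter α), 0 < N x)
    (hA : Tendsto A U (𝓝 SG)) (hSG : SG.PosDef)
    (hB : Tendsto (fun x => (N x : ℝ)⁻¹ • ((Φ x)ᵀ * Φ x)) U (𝓝 SPhi)) (hSPhi : SPhi.PosDef)
    (hdist : DistinctEigenvalues (SG * SPhi)) (hXi : IsLimitRotation SG SPhi Xi0)
    (hE : Tendsto (fun x => Real.sqrt (N x) * sqFrob (E x)) U (𝓝 0))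
    (hY : ∀ᶠ x in (U : Filter α), Y x = (N x : ℝ)⁻¹ • (Φ x * A x * (Φ x)ᵀ) + E x)
    (hLL : ∀ᶠ x in (U : Filter α), (L x)ᵀ * L x = (N x : ℝ) • (1 : Matrix (Fin r) (Fin r) ℝ))
    (hd : ∀ᶠ x in (U : Filter α), Antitone (d x))
    (hYL : ∀ᶠ x in (U : Filter α), Y x * L x = L x * Matrix.diagonal (d x))
    (hmax : ∀ᶠ x in (U : Filter α), ∀ w : Fin (N x) → ℝ, (L x)ᵀ *ᵥ w = 0 →
      ∀ l, w ⬝ᵥ (Y x *ᵥ w) ≤ d x l * (w ⬝ᵥ w)) {B : ℝ}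
    (hm : ∀ᶠ x in (U : Filter α), ∀ c, avg (fun i => (Φ x * (Xi0ᵀ)⁻¹) i c ^ 4) ≤ B) :
    ∃ s : Fin r → ℝ, (∀ a, s a ^ 2 = 1) ∧ ∀ b, Tendsto (fun x => avg fun i =>
      (L x * Matrix.diagonal s - Φ x * (Xi0ᵀ)⁻¹) i b ^ 4) U (𝓝 0) := by
  have hE0 : Tendsto (fun x => sqFrob (E x)) U (𝓝 0) := by
    refine tendsto_of_tendsto_of_tendsto_of_le_of_le' tendsto_const_nhds hE
      (Eventually.of_forall fun _ => sqFrob_nonneg _) ?_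
    filter_upwards [hN] with x hx
    have h1 : (1 : ℝ) ≤ Real.sqrt (N x) := Real.one_le_sqrt.2 (by exact_mod_cast hx)
    exact le_mul_of_one_le_left (sqFrob_nonneg _) h1
  obtain ⟨P, v, hProt, hP, hdv, hV, hv⟩ :=
    exists_pc_limit hN hA hSG hB hSPhi hE0 hY hLL hd hYL hmax
  obtain ⟨s, hs, hPs⟩ := hXi.eq_mul_diagonal hSPhi hdist hProt
  refine ⟨s, hs, fun b => ?_⟩
  have hXu : IsUnit Xi0ᵀ.det := by rw [Matrix.det_transpose]; exact hXi.isUnit_det hSPhi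
  have hss : Matrix.diagonal s * Matrix.diagonal s = 1 := by
    rw [Matrix.diagonal_mul_diagonal, ← Matrix.diagonal_one]
    congr 1; ext a; rw [← sq, hs]
  have hdinv : Tendsto (fun x => Matrix.diagonal fun l => (d x l)⁻¹) U
      (𝓝 (Matrix.diagonal fun l => (v l)⁻¹)) :=
    tendsto_diagonal fun l => (hdv l).inv₀ (hv l).ne'
  -- `R` is the relative error of the bracket: multiplied by the rotated loadings it gives the whole
  -- deviation apart from the contribution of `E`.
  obtain ⟨R, hR⟩ : ∃ R : α → Matrix (Fin r) (Fin r) ℝ, R = fun x =>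
    Xi0ᵀ * (A x * ((N x : ℝ)⁻¹ • ((Φ x)ᵀ * L x)) * Matrix.diagonal (fun l => (d x l)⁻¹)) *
      Matrix.diagonal s - 1 := ⟨_, rfl⟩
  have hR0 : Tendsto R U (𝓝 0) := by
    have h := ((((hA.mul hP).mul hdinv).const_mul Xi0ᵀ).mul_const (Matrix.diagonal s)).sub
      (tendsto_const_nhds (x := (1 : Matrix (Fin r) (Fin r) ℝ)))
    have h1 : Xi0ᵀ * (SG * P * Matrix.diagonal fun l => (v l)⁻¹) * Matrix.diagonal s - 1 = 0 := by
      have h2 : Xi0ᵀ = Matrix.diagonal s * Pᵀ := by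
        rw [hPs, Matrix.transpose_mul, Matrix.diagonal_transpose, ← Matrix.mul_assoc, hss,
          Matrix.one_mul]
      have h3 : Matrix.diagonal v * (Matrix.diagonal fun l => (v l)⁻¹) = 1 := by
        rw [Matrix.diagonal_mul_diagonal, ← Matrix.diagonal_one]
        congr 1; ext a; exact mul_inv_cancel₀ (hv a).ne'
      rw [h2, sub_eq_zero]
      calc _ = Matrix.diagonal s * ((Pᵀ * SG * P) * Matrix.diagonal fun l => (v l)⁻¹) *
            Matrix.diagonal s := by simp only [Matrix.mul_assoc]
        _ = 1 := by rw [hV, h3, Matrix.mul_one, hss]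
    rw [h1] at h
    rw [hR]; exact h
  obtain ⟨D, hD⟩ : ∃ D : α → Matrix (Fin r) (Fin r) ℝ, D = fun x =>
    Matrix.diagonal (fun l => (d x l)⁻¹) * Matrix.diagonal s := ⟨_, rfl⟩
  have hDlim : Tendsto (fun x => sqFrob (D x)) U
      (𝓝 (sqFrob (Matrix.diagonal (fun l => (v l)⁻¹) * Matrix.diagonal s))) := by
    have h := hdinv.mul_const (Matrix.diagonal s)
    rw [hD]
    exact tendsto_finsetSum _ fun a _ => tendsto_finsetSum _ fun b _ =>
      (tendsto_matrix_iff.1 h a b).pow 2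
  have hK : ∀ᶠ x in (U : Filter α), L x * Matrix.diagonal s - Φ x * (Xi0ᵀ)⁻¹ =
      E x * (L x * D x) + (Φ x * (Xi0ᵀ)⁻¹) * R x := by
    have hdne : ∀ᶠ x in (U : Filter α), ∀ l, d x l ≠ 0 :=
      eventually_all.2 fun l => (hdv l).eventually_ne (hv l).ne'
    filter_upwards [hN, hY, hYL, hdne] with x hx h1 h2 h3
    have h4 : Matrix.diagonal (d x) * (Matrix.diagonal fun l => (d x l)⁻¹) = 1 := by
      rw [Matrix.diagonal_mul_diagonal, ← Matrix.diagonal_one]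
      congr 1; ext a; exact mul_inv_cancel₀ (h3 a)
    have h5 : L x = Y x * L x * Matrix.diagonal fun l => (d x l)⁻¹ := by
      rw [h2, Matrix.mul_assoc, h4, Matrix.mul_one]
    have h6 : (Φ x * (Xi0ᵀ)⁻¹) * R x = Φ x * (A x * ((N x : ℝ)⁻¹ • ((Φ x)ᵀ * L x)) *
        Matrix.diagonal (fun l => (d x l)⁻¹)) * Matrix.diagonal s - Φ x * (Xi0ᵀ)⁻¹ := by
      rw [hR]
      simp only [Matrix.mul_sub, Matrix.mul_one]
      congr 1
      calc _ = Φ x * ((Xi0ᵀ)⁻¹ * Xi0ᵀ) * (A x * ((N x : ℝ)⁻¹ • ((Φ x)ᵀ * L x)) *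
            Matrix.diagonal (fun l => (d x l)⁻¹)) * Matrix.diagonal s := by
            simp only [Matrix.mul_assoc]
        _ = _ := by rw [Matrix.nonsing_inv_mul _ hXu, Matrix.mul_one]
    rw [h6, ← add_sub_assoc]
    congr 1
    conv_lhs => rw [h5, h1]
    rw [hD]
    simp only [Matrix.add_mul, Matrix.smul_mul, Matrix.mul_smul, Matrix.mul_assoc]
    rw [add_comm]
  -- As `‖L‖² = N r`, the average is at most `N ‖E‖⁴ (r ‖D‖²)²`, which is the square of `√N ‖E‖²`
  -- times a bounded factor.
  have hEL : Tendsto (fun x => avg fun i => (E x * (L x * D x)) i b ^ 4) U (𝓝 0) := by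
    have h : Tendsto (fun x => (Real.sqrt (N x) * sqFrob (E x)) ^ 2 *
        ((r : ℝ) * sqFrob (D x)) ^ 2) U (𝓝 0) := by
      simpa using (hE.pow 2).mul ((hDlim.const_mul (r : ℝ)).pow 2)
    refine tendsto_of_tendsto_of_tendsto_of_le_of_le' tendsto_const_nhds h
      (Eventually.of_forall fun _ => avg_nonneg fun _ => by positivity) ?_
    filter_upwards [hN, hLL] with x hx h1
    refine (avg_pow_four_le hx _ b).trans ?_
    have hx' : (0 : ℝ) < N x := by exact_mod_cast hx
    have h2 : sqFrob (E x * (L x * D x)) ≤ sqFrob (E x) * (N x * r * sqFrob (D x)) := by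
      refine (sqFrob_mul_le _ _).trans (mul_le_mul_of_nonneg_left ?_ (sqFrob_nonneg _))
      rw [← sqFrob_of_transpose_mul_self h1]
      exact sqFrob_mul_le _ _
    calc _ ≤ 1 / (N x : ℝ) * (sqFrob (E x) * (N x * r * sqFrob (D x))) ^ 2 :=
          mul_le_mul_of_nonneg_left (pow_le_pow_left₀ (sqFrob_nonneg _) h2 2) (by positivity)
      _ = _ := by
          rw [mul_pow (Real.sqrt _), Real.sq_sqrt hx'.le]
          field_simp
  refine (tendsto_avg_pow_four_add_zero hEL (tendsto_avg_pow_four_mul hm hR0 b)).congr' ?_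
  filter_upwards [hK] with x hx
  rw [hx]; rfl

end Loadings

/-! ### Convergence of the test statistic -/

section Statistic

variable {α : Type*} {F : Filter α} {S r : ℕ} {N : α → ℕ} {grp : (x : α) → Fin (N x) → Fin S}
  {m M : (x : α) → Matrix (Fin (N x)) (Fin r) ℝ} {B : ℝ} {pr : Fin S → ℝ}

/-- With `K = M - m`, the difference of products is `K_a K_b + K_a m_b + K_b m_a`. Cauchy–Schwarz
bounds each average of squares by fourth moments. -/
theorem tendsto_avg_products (hm : ∀ᶠ x in F, ∀ c, avg (fun i => m x i c ^ 4) ≤ B)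
    (hK : ∀ b, Tendsto (fun x => avg fun i => (M x - m x) i b ^ 4) F (𝓝 0)) (a b : Fin r) :
    Tendsto (fun x => avg fun i => (M x i a * M x i b - m x i a * m x i b) ^ 2) F (𝓝 0) := by
  have hK2 : ∀ b, Tendsto (fun x => avg fun i => ((M x - m x) i b ^ 2) ^ 2) F (𝓝 0) := by
    intro b
    simpa only [← pow_mul] using hK b
  have hm2 : ∀ b, ∀ᶠ x in F, avg (fun i => (m x i b ^ 2) ^ 2) ≤ B := by
    intro b
    filter_upwards [hm] with x hx
    simpa only [← pow_mul] using hx b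
  have h1 : ∀ a b, Tendsto (fun x => avg fun i => ((M x - m x) i a * m x i b) ^ 2) F (𝓝 0) := by
    intro a b
    simpa only [mul_pow] using tendsto_avg_mul_zero (hK2 a) (hm2 b)
  have h2 : Tendsto (fun x => avg fun i => ((M x - m x) i a * (M x - m x) i b) ^ 2) F (𝓝 0) := by
    simpa only [mul_pow] using tendsto_avg_mul_zero (hK2 a) ((hK2 b).eventually_le_const one_pos)
  refine (tendsto_avg_sq_add_zero (tendsto_avg_sq_add_zero h2 (h1 a b)) (h1 b a)).congr fun x => ?_
  congr 1; ext i
  simp only [Matrix.sub_apply]; ring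

/-- A group moment is an average over all variables against the group indicator, divided by the
group share, so Cauchy–Schwarz against the indicator suffices. -/
theorem tendsto_groupMoment_of_loadings (hN : ∀ᶠ x in F, 0 < N x)
    (hshare : ∀ j, Tendsto (fun x => (groupSize (grp x) j : ℝ) / (N x : ℝ)) F (𝓝 (pr j)))
    (hpr : ∀ j, 0 < pr j) (hm : ∀ᶠ x in F, ∀ c, avg (fun i => m x i c ^ 4) ≤ B)
    (hK : ∀ b, Tendsto (fun x => avg fun i => (M x - m x) i b ^ 4) F (𝓝 0)) {j : Fin S}
    {Q : Matrix (Fin r) (Fin r) ℝ} (hQ : Tendsto (fun x => groupMoment (grp x) (m x) j) F (𝓝 Q)) :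
    Tendsto (fun x => groupMoment (grp x) (M x) j) F (𝓝 Q) := by
  refine tendsto_matrix_iff.2 fun a b => ?_
  have hind : ∀ᶠ x in F, avg (fun i => groupInd (grp x) j i ^ 2) ≤ 1 :=
    Eventually.of_forall fun x => (avg_mono fun i => by
      unfold groupInd; split_ifs <;> norm_num).trans (avg_const_le zero_le_one)
  have h1 := (hshare j).inv₀ (hpr j).ne'
  have h2 := h1.mul (tendsto_avg_mul_zero (tendsto_avg_products hm hK a b) hind)
  have h3 := (tendsto_matrix_iff.1 hQ a b).add h2
  rw [mul_zero, add_zero] at h3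
  refine h3.congr' ?_
  filter_upwards [hN] with x hx
  have hx' : (N x : ℝ) ≠ 0 := by exact_mod_cast hx.ne'
  rw [groupMoment_apply, groupMoment_apply, avg]
  have h4 : ∑ i, groupInd (grp x) j i * (M x i a * M x i b) =
      ∑ i, groupInd (grp x) j i * (m x i a * m x i b) +
      ∑ i, (M x i a * M x i b - m x i a * m x i b) * groupInd (grp x) j i := by
    rw [← Finset.sum_add_distrib]
    exact Finset.sum_congr rfl fun i _ => by ring
  rw [h4, mul_add, inv_div]
  congr 1
  rw [← mul_assoc]
  congr 1
  field_simp

/-- A product of two centered entries changes by `(Y_p - W_p) Y_q + (Y_q - W_q) W_p`, with `Y` from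
`M` and `W` from `m`. The differences vanish in mean square, and the other factors are bounded in
mean square. -/
theorem tendsto_statS_of_loadings
    (hshare : ∀ j, Tendsto (fun x => (groupSize (grp x) j : ℝ) / (N x : ℝ)) F (𝓝 (pr j)))
    (hpr : ∀ j, 0 < pr j) (hm : ∀ᶠ x in F, ∀ c, avg (fun i => m x i c ^ 4) ≤ B)
    (hK : ∀ b, Tendsto (fun x => avg fun i => (M x - m x) i b ^ 4) F (𝓝 0)) {j k : Fin S}
    {V : Matrix (VechIdx r) (VechIdx r) ℝ}
    (hV : Tendsto (fun x => statS (grp x) j k (m x)) F (𝓝 V)) :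
    Tendsto (fun x => statS (grp x) j k (M x)) F (𝓝 V) := by
  refine tendsto_matrix_iff.2 fun p q => ?_
  have hfac : Tendsto (fun x => (N x : ℝ) / groupSize (grp x) j + (N x : ℝ) / groupSize (grp x) k)
      F (𝓝 ((pr j)⁻¹ + (pr k)⁻¹)) := by
    simpa only [inv_div] using ((hshare j).inv₀ (hpr j).ne').add ((hshare k).inv₀ (hpr k).ne')
  obtain ⟨c, hc⟩ : ∃ c : VechIdx r → ℝ, c = fun p =>
    (1 : Matrix (Fin r) (Fin r) ℝ) p.1.1 p.1.2 := ⟨_, rfl⟩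
  have hc1 : ∀ p, c p ^ 2 ≤ 1 := by
    intro p
    rw [hc]
    simp only [Matrix.one_apply]
    split_ifs <;> norm_num
  have hdiff : ∀ p : VechIdx r, Tendsto (fun x => avg fun i => ((M x i p.1.1 * M x i p.1.2 - c p) -
      (m x i p.1.1 * m x i p.1.2 - c p)) ^ 2) F (𝓝 0) := by
    intro p
    simpa only [sub_sub_sub_cancel_right] using tendsto_avg_products hm hK p.1.1 p.1.2
  have hW : ∀ p : VechIdx r, ∀ᶠ x in F,
      avg (fun i => (m x i p.1.1 * m x i p.1.2 - c p) ^ 2) ≤ 2 * B + 2 := by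
    intro p
    filter_upwards [hm] with x hx
    have h1 : ∀ i, (m x i p.1.1 * m x i p.1.2 - c p) ^ 2 ≤ m x i p.1.1 ^ 4 + m x i p.1.2 ^ 4 + 2 := by
      intro i
      nlinarith [sq_nonneg (m x i p.1.1 * m x i p.1.2 + c p), hc1 p,
        sq_nonneg (m x i p.1.1 ^ 2 - m x i p.1.2 ^ 2)]
    refine (avg_mono h1).trans ?_
    rw [avg_add, avg_add]
    linarith [hx p.1.1, hx p.1.2, avg_const_le (n := N x) (zero_le_two (α := ℝ))]
  have hY : ∀ p : VechIdx r, ∀ᶠ x in F,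
      avg (fun i => (M x i p.1.1 * M x i p.1.2 - c p) ^ 2) ≤ 2 * (1 + (2 * B + 2)) := by
    intro p
    filter_upwards [hW p, (hdiff p).eventually_le_const one_pos] with x h1 h2
    have h3 : ∀ i, (M x i p.1.1 * M x i p.1.2 - c p) ^ 2 ≤
        2 * (((M x i p.1.1 * M x i p.1.2 - c p) - (m x i p.1.1 * m x i p.1.2 - c p)) ^ 2 +
        (m x i p.1.1 * m x i p.1.2 - c p) ^ 2) := by
      intro i
      nlinarith [sq_nonneg (((M x i p.1.1 * M x i p.1.2 - c p) -
        (m x i p.1.1 * m x i p.1.2 - c p)) - (m x i p.1.1 * m x i p.1.2 - c p))]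
    refine (avg_mono h3).trans ?_
    rw [avg_const_mul, avg_add]
    linarith
  have h := (tendsto_matrix_iff.1 hV p q).add (hfac.mul
    ((tendsto_avg_mul_zero (hdiff p) (hY q)).add (tendsto_avg_mul_zero (hdiff q) (hW p))))
  rw [add_zero, mul_zero, add_zero] at h
  refine h.congr fun x => ?_
  rw [statS_apply, statS_apply, ← avg_add, ← mul_add]
  congr 1
  change avg _ + avg _ = avg _
  rw [← avg_add]
  congr 1; ext i
  rw [hc]; ring

theorem statLM_div {n : ℕ} (hn : 0 < n) (grp : Fin n → Fin S) (j k : Fin S)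
    (L : Matrix (Fin n) (Fin r) ℝ) : statLM grp j k L / n =
      vech (groupMoment grp L j - groupMoment grp L k) ⬝ᵥ ((statS grp j k L)⁻¹ *ᵥ
        vech (groupMoment grp L j - groupMoment grp L k)) := by
  have h1 : statA grp j k L = Real.sqrt n • vech (groupMoment grp L j - groupMoment grp L k) := rfl
  have hn' : (0 : ℝ) < n := by exact_mod_cast hn
  rw [statLM, h1, Matrix.mulVec_smul, dotProduct_smul, smul_dotProduct, smul_smul,
    Real.mul_self_sqrt hn'.le, smul_eq_mul, mul_div_cancel_left₀ _ hn'.ne']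

theorem tendsto_statLM_of_loadings (hN : ∀ᶠ x in F, 0 < N x)
    (hshare : ∀ j, Tendsto (fun x => (groupSize (grp x) j : ℝ) / (N x : ℝ)) F (𝓝 (pr j)))
    (hpr : ∀ j, 0 < pr j) (hm : ∀ᶠ x in F, ∀ c, avg (fun i => m x i c ^ 4) ≤ B)
    (hK : ∀ b, Tendsto (fun x => avg fun i => (M x - m x) i b ^ 4) F (𝓝 0)) {j k : Fin S}
    {Qj Qk : Matrix (Fin r) (Fin r) ℝ} {V : Matrix (VechIdx r) (VechIdx r) ℝ}
    (hQj : Tendsto (fun x => groupMoment (grp x) (m x) j) F (𝓝 Qj))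
    (hQk : Tendsto (fun x => groupMoment (grp x) (m x) k) F (𝓝 Qk))
    (hV : Tendsto (fun x => statS (grp x) j k (m x)) F (𝓝 V)) (hVdet : IsUnit V.det) :
    Tendsto (fun x => statLM (grp x) j k (M x) / N x) F
      (𝓝 (vech (Qj - Qk) ⬝ᵥ (V⁻¹ *ᵥ vech (Qj - Qk)))) := by
  have h1 : Tendsto (fun x => vech (groupMoment (grp x) (M x) j - groupMoment (grp x) (M x) k)) F
      (𝓝 (vech (Qj - Qk))) := by
    have h := (tendsto_groupMoment_of_loadings hN hshare hpr hm hK hQj).sub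
      (tendsto_groupMoment_of_loadings hN hshare hpr hm hK hQk)
    exact tendsto_pi_nhds.2 fun p => tendsto_matrix_iff.1 h _ _
  have h2 := tendsto_matrix_inv (tendsto_statS_of_loadings hshare hpr hm hK hV) hVdet
  refine (tendsto_dotProduct h1 (tendsto_mulVec h2 h1)).congr' ?_
  filter_upwards [hN] with x hx
  rw [statLM_div hx]

/-- The diagonal of the variance estimator bounds the fourth moments of the loadings. -/
theorem exists_avg_pow_four_le
    (hshare : ∀ j, Tendsto (fun x => (groupSize (grp x) j : ℝ) / (N x : ℝ)) F (𝓝 (pr j)))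
    (hpr : ∀ j, 0 < pr j) {j k : Fin S} {V : Matrix (VechIdx r) (VechIdx r) ℝ}
    (hV : Tendsto (fun x => statS (grp x) j k (m x)) F (𝓝 V)) :
    ∃ B, ∀ᶠ x in F, ∀ c, avg (fun i => m x i c ^ 4) ≤ B := by
  have hfac : Tendsto (fun x => (N x : ℝ) / groupSize (grp x) j + (N x : ℝ) / groupSize (grp x) k)
      F (𝓝 ((pr j)⁻¹ + (pr k)⁻¹)) := by
    simpa only [inv_div] using ((hshare j).inv₀ (hpr j).ne').add ((hshare k).inv₀ (hpr k).ne')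
  have hpos : 0 < (pr j)⁻¹ + (pr k)⁻¹ := add_pos (inv_pos.2 (hpr j)) (inv_pos.2 (hpr k))
  obtain ⟨dg, hdg⟩ : ∃ dg : Fin r → VechIdx r, dg = fun c => ⟨(c, c), le_rfl⟩ := ⟨_, rfl⟩
  have hlim : ∀ c, Tendsto (fun x => avg fun i => (m x i c * m x i c - 1) ^ 2) F
      (𝓝 (V (dg c) (dg c) / ((pr j)⁻¹ + (pr k)⁻¹))) := by
    intro c
    refine ((tendsto_matrix_iff.1 hV (dg c) (dg c)).div hfac hpos.ne').congr' ?_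
    filter_upwards [hfac.eventually_ne hpos.ne'] with x hx
    rw [Pi.div_apply, statS_apply, mul_div_cancel_left₀ _ hx, hdg]
    simp only [Matrix.one_apply_eq, ← sq]
    rfl
  obtain ⟨β, hβ⟩ : ∃ β : Fin r → ℝ, β = fun c =>
    2 * (V (dg c) (dg c) / ((pr j)⁻¹ + (pr k)⁻¹) + 1) + 2 := ⟨_, rfl⟩
  refine ⟨∑ c, |β c|, eventually_all.2 fun c => ?_⟩
  filter_upwards [(hlim c).eventually_lt_const (lt_add_one _)] with x hx
  have h1 : ∀ i, m x i c ^ 4 ≤ 2 * (m x i c * m x i c - 1) ^ 2 + 2 := fun i => by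
    nlinarith [sq_nonneg (m x i c * m x i c - 2)]
  have h2 : avg (fun i => m x i c ^ 4) ≤ β c := by
    refine (avg_mono h1).trans ?_
    rw [avg_add, avg_const_mul, hβ]
    linarith [avg_const_le (n := N x) (zero_le_two (α := ℝ))]
  exact h2.trans ((le_abs_self _).trans (Finset.single_le_sum (f := fun c => |β c|)
    (fun _ _ => abs_nonneg _) (Finset.mem_univ c)))

theorem groupMoment_mul {n : ℕ} (grp : Fin n → Fin S) (L : Matrix (Fin n) (Fin r) ℝ)
    (Z : Matrix (Fin r) (Fin r) ℝ) (j : Fin S) :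
    groupMoment grp (L * Z) j = Zᵀ * groupMoment grp L j * Z := by
  have h : ∀ i, Matrix.vecMulVec ((L * Z) i) ((L * Z) i) =
      Zᵀ * Matrix.vecMulVec (L i) (L i) * Z := by
    intro i
    have h1 : (L * Z) i = L i ᵥ* Z := rfl
    rw [h1, Matrix.mul_vecMulVec, Matrix.vecMulVec_mul, Matrix.mulVec_transpose]
  simp only [groupMoment, h, ← Finset.sum_mul, ← Finset.mul_sum, Matrix.smul_mul, Matrix.mul_smul]

end Statistic

/-! ### Stochastic orders of the error terms -/

section Panel

variable {Ω : Type*} {S rc rs : ℕ} {rg : Fin S → ℕ} {D : Panel Ω S rc rs rg} {pr : Fin S → ℝ} {C : ℝ}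

theorem Panel.Asymptotics.eventually_N_pos (h : D.Asymptotics pr) : ∀ᶠ n in atTop, 0 < D.N n :=
  h.N_tendsto.eventually_gt_atTop 0

theorem Panel.Asymptotics.eventually_T_pos (h : D.Asymptotics pr) : ∀ᶠ n in atTop, 0 < D.T n :=
  h.T_tendsto.eventually_gt_atTop 0

theorem Panel.Asymptotics.groupSize_tendsto (h : D.Asymptotics pr) (j : Fin S) :
    Tendsto (fun n => (groupSize (D.grp n) j : ℝ)) atTop atTop := by
  have h1 : Tendsto (fun n => (groupSize (D.grp n) j : ℝ) / D.N n * D.N n) atTop atTop :=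
    (h.share j).pos_mul_atTop (h.share_pos j)
      (tendsto_natCast_atTop_atTop.comp h.N_tendsto)
  refine h1.congr' ?_
  filter_upwards [h.eventually_N_pos] with n hn
  have : (D.N n : ℝ) ≠ 0 := by exact_mod_cast hn.ne'
  field_simp

variable [MeasurableSpace Ω] {μ : Measure Ω}

/-- The error covariances are uniformly bounded. -/
theorem abs_sigma_le [IsProbabilityMeasure μ]
    (hm : ∀ n i t, MeanLe μ (fun ω => |D.e n i t ω| ^ 8) C) (n : ℕ)
    (i j : Fin (D.N n)) (t s : Fin (D.T n)) : |D.sigma μ n i j t s| ≤ 1 + C := by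
  have hadd : Integrable (fun ω => |D.e n i t ω| ^ 8 + |D.e n j s ω| ^ 8) μ :=
    (hm n i t).1.add (hm n j s).1
  have hint : Integrable (fun ω => 1 + (|D.e n i t ω| ^ 8 + |D.e n j s ω| ^ 8) * 2⁻¹) μ :=
    (integrable_const _).add (hadd.mul_const _)
  have h := norm_integral_le_of_norm_le (f := fun ω => D.e n i t ω * D.e n j s ω) hint
    (ae_of_all _ fun ω => by
      -- Combined with `|a b| ≤ (a² + b²) / 2`, this dominates the product by the integrable
      -- function above.
      have h8 : ∀ y : ℝ, y ^ 2 ≤ 1 + |y| ^ 8 := by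
        intro y
        have h : |y| ^ 8 = (y ^ 2) ^ 4 := by rw [← sq_abs]; ring
        rw [h]
        nlinarith [sq_nonneg (y ^ 2 - 1), sq_nonneg ((y ^ 2) ^ 2 - 1), sq_nonneg (y ^ 2)]
      rw [Real.norm_eq_abs, abs_le]
      constructor <;> nlinarith [h8 (D.e n i t ω), h8 (D.e n j s ω),
        sq_nonneg (D.e n i t ω + D.e n j s ω), sq_nonneg (D.e n i t ω - D.e n j s ω)])
  rw [Real.norm_eq_abs] at h
  refine h.trans ?_
  rw [integral_add (integrable_const _) (hadd.mul_const _),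
    integral_mul_const]
  have h2 : ∫ ω, |D.e n i t ω| ^ 8 + |D.e n j s ω| ^ 8 ∂μ ≤ C + C := by
    rw [integral_add (hm n i t).1 (hm n j s).1]
    exact add_le_add (hm n i t).2 (hm n j s).2
  simp only [integral_const, probReal_univ, smul_eq_mul, mul_one]
  linarith

/-- `√N ‖e eᵀ / (N T)‖² → 0` in probability. -/
theorem tendsto_sqFrob_err_mul_transpose [IsProbabilityMeasure μ] (has : D.Asymptotics pr)
    (hm : ∀ n i t, MeanLe μ (fun ω => |D.e n i t ω| ^ 8) C)
    (hdep : ∀ n, ∃ (sbar : Fin (D.N n) → Fin (D.N n) → ℝ) (tau : Fin (D.T n) → Fin (D.T n) → ℝ),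
      (∀ i j t s, |D.sigma μ n i j t s| ≤ sbar i j) ∧
      (∀ i j t s, |D.sigma μ n i j t s| ≤ tau s t) ∧
      (1 / (D.N n : ℝ)) * ∑ i, ∑ j, sbar i j ≤ C ∧
      (1 / (D.T n : ℝ)) * ∑ t, ∑ s, tau s t ≤ C ∧
      (1 / ((D.N n : ℝ) * (D.T n : ℝ))) * ∑ i, ∑ j, ∑ t, ∑ s, |D.sigma μ n i j t s| ≤ C)
    (hcross : ∀ n t s, MeanLe μ (fun ω => |(1 / Real.sqrt (D.N n)) *
      ∑ i, (D.e n i t ω * D.e n i s ω - D.sigma μ n i i t s)| ^ 4) C) :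
    Tendsto (fun x : ℕ × Ω => Real.sqrt (D.N x.1) *
      sqFrob ((1 / ((D.N x.1 : ℝ) * D.T x.1)) • (D.err x.1 x.2 * (D.err x.1 x.2)ᵀ)))
      (probFilter μ) (𝓝 0) := by
  obtain ⟨Z, hZ⟩ : ∃ Z : (n : ℕ) → Fin (D.T n) → Fin (D.T n) → Ω → ℝ, Z = fun n t s ω =>
    (1 / Real.sqrt (D.N n)) * ∑ i, (D.e n i t ω * D.e n i s ω - D.sigma μ n i i t s) := ⟨_, rfl⟩
  have hZm : ∀ n t s, MeanLe μ (fun ω => |Z n t s ω| ^ 4) C := by rw [hZ]; exact hcross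
  -- the average of the fourth powers
  obtain ⟨W, hW⟩ : ∃ W : ℕ → Ω → ℝ, W = fun n ω =>
    (1 / (D.T n : ℝ)) ^ 2 * ∑ t, ∑ s, |Z n t s ω| ^ 4 := ⟨_, rfl⟩
  have hW0 : ∀ n ω, 0 ≤ W n ω := by
    intro n ω; rw [hW]; positivity
  -- The sign of `C` is not a hypothesis; for `T n = 0` the average `W` is zero and the bound must
  -- be nonnegative.
  obtain ⟨C', hC'⟩ : ∃ C' : ℝ, C' = max C 0 := ⟨_, rfl⟩
  have hCC' : C ≤ C' := hC' ▸ le_max_left _ _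
  have hC0 : 0 ≤ C' := hC' ▸ le_max_right _ _
  have hWm : ∀ n, MeanLe μ (W n) C' := by
    intro n
    rw [hW]
    have hi : ∀ t ∈ (Finset.univ : Finset (Fin (D.T n))),
        Integrable (fun ω => ∑ s, |Z n t s ω| ^ 4) μ := fun t _ =>
      integrable_finsetSum _ fun s _ => (hZm n t s).1
    refine ⟨(integrable_finsetSum _ hi).const_mul _, ?_⟩
    rw [integral_const_mul, integral_finsetSum _ hi]
    have h1 : ∑ t, ∫ ω, ∑ s, |Z n t s ω| ^ 4 ∂μ ≤ ∑ _t : Fin (D.T n), ∑ _s : Fin (D.T n), C' := by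
      refine Finset.sum_le_sum fun t _ => ?_
      rw [integral_finsetSum _ fun s _ => (hZm n t s).1]
      exact Finset.sum_le_sum fun s _ => (hZm n t s).2.trans hCC'
    refine (mul_le_mul_of_nonneg_left h1 (sq_nonneg _)).trans ?_
    simp only [Finset.sum_const, Finset.card_univ, Fintype.card_fin, nsmul_eq_mul]
    rcases Nat.eq_zero_or_pos (D.T n) with h | h
    · simpa [h] using hC0
    · have : (D.T n : ℝ) ≠ 0 := by positivity
      refine le_of_eq ?_
      field_simp
  -- deterministic bound
  have hbound : ∀ n ω, 0 < D.N n → 0 < D.T n → Real.sqrt (D.N n) *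
      sqFrob ((1 / ((D.N n : ℝ) * D.T n)) • (D.err n ω * (D.err n ω)ᵀ)) ≤
      2 * (Real.sqrt (D.N n))⁻¹ + 2 * ((Real.sqrt (D.N n))⁻¹ * W n ω) +
        2 * ((1 + C') * C') * (Real.sqrt (D.N n) / D.T n) := by
    intro n ω hN hT
    have hN' : (0 : ℝ) < D.N n := by exact_mod_cast hN
    have hT' : (0 : ℝ) < D.T n := by exact_mod_cast hT
    have hq : 0 < Real.sqrt (D.N n) := Real.sqrt_pos.2 hN'
    have hqq : Real.sqrt (D.N n) ^ 2 = D.N n := Real.sq_sqrt hN'.le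
    obtain ⟨sbar, tau, -, ht, -, hts, -⟩ := hdep n
    have hentry : ∀ t s, ((D.err n ω)ᵀ * D.err n ω) t s =
        Real.sqrt (D.N n) * Z n t s ω + ∑ i, D.sigma μ n i i t s := by
      intro t s
      rw [hZ, ← mul_assoc, mul_one_div_cancel hq.ne', one_mul, ← Finset.sum_add_distrib,
        Matrix.mul_apply]
      exact Finset.sum_congr rfl fun i _ => by simp [Panel.err]
    -- One factor of the square is bounded by the summable `tau`, the other by a constant. The sum
    -- over `t` and `s` is then of order `N² T` instead of `N² T²`, which yields the term `√N / T`.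
    have hsig : ∀ t s, (∑ i, D.sigma μ n i i t s) ^ 2 ≤ (D.N n : ℝ) ^ 2 * ((1 + C') * tau s t) := by
      intro t s
      have h1 : |∑ i, D.sigma μ n i i t s| ≤ D.N n * tau s t := by
        refine (Finset.abs_sum_le_sum_abs _ _).trans
          ((Finset.sum_le_sum fun i _ => ht i i t s).trans ?_)
        simp
      have h2 : |∑ i, D.sigma μ n i i t s| ≤ D.N n * (1 + C') := by
        refine (Finset.abs_sum_le_sum_abs _ _).trans
          ((Finset.sum_le_sum fun i _ => (abs_sigma_le hm n i i t s)).trans ?_)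
        simp only [Finset.sum_const, Finset.card_univ, Fintype.card_fin, nsmul_eq_mul]
        gcongr
      rw [← sq_abs, sq]
      calc _ ≤ (D.N n * (1 + C')) * (D.N n * tau s t) :=
            mul_le_mul h2 h1 (abs_nonneg _) (by positivity)
        _ = _ := by ring
    have hsq : sqFrob (D.err n ω * (D.err n ω)ᵀ) ≤ 2 * D.N n * (D.T n ^ 2 * (1 + W n ω)) +
        2 * (D.N n : ℝ) ^ 2 * ((1 + C') * (D.T n * C')) := by
      rw [sqFrob_mul_transpose]
      have h1 : ∀ t s, ((D.err n ω)ᵀ * D.err n ω) t s ^ 2 ≤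
          2 * D.N n * (1 + |Z n t s ω| ^ 4) + 2 * ((D.N n : ℝ) ^ 2 * ((1 + C') * tau s t)) := by
        intro t s
        rw [hentry]
        have h2 : (Z n t s ω) ^ 2 ≤ 1 + |Z n t s ω| ^ 4 := by
          have h : |Z n t s ω| ^ 4 = (Z n t s ω ^ 2) ^ 2 := by
            rw [← sq_abs (Z n t s ω)]; ring
          rw [h]
          nlinarith [sq_nonneg (Z n t s ω ^ 2 - 1), sq_nonneg (Z n t s ω)]
        have h3 : (Real.sqrt (D.N n) * Z n t s ω) ^ 2 ≤ D.N n * (1 + |Z n t s ω| ^ 4) := by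
          rw [mul_pow, hqq]
          exact mul_le_mul_of_nonneg_left h2 hN'.le
        nlinarith [sq_nonneg (Real.sqrt (D.N n) * Z n t s ω - ∑ i, D.sigma μ n i i t s), hsig t s]
      refine (Finset.sum_le_sum fun t _ => Finset.sum_le_sum fun s _ => h1 t s).trans ?_
      simp only [Finset.sum_add_distrib, ← Finset.mul_sum]
      have h4 : ∑ t, ∑ s, tau s t ≤ D.T n * C' := by
        rw [one_div, inv_mul_le_iff₀ hT'] at hts
        exact hts.trans (mul_le_mul_of_nonneg_left hCC' hT'.le)
      have h5 : ∑ t, ∑ s, |Z n t s ω| ^ 4 = D.T n ^ 2 * W n ω := by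
        rw [hW]; field_simp
      rw [h5]
      simp only [Finset.sum_const, Finset.card_univ, Fintype.card_fin, nsmul_eq_mul, mul_one]
      have h6 : (1 + C') * ∑ t, ∑ s, tau s t ≤ (1 + C') * (D.T n * C') :=
        mul_le_mul_of_nonneg_left h4 (by positivity)
      have h7 := mul_le_mul_of_nonneg_left h6 (by positivity : 0 ≤ 2 * (D.N n : ℝ) ^ 2)
      linarith
    rw [sqFrob_smul]
    calc _ ≤ Real.sqrt (D.N n) * ((1 / ((D.N n : ℝ) * D.T n)) ^ 2 *
          (2 * D.N n * (D.T n ^ 2 * (1 + W n ω)) +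
            2 * (D.N n : ℝ) ^ 2 * ((1 + C') * (D.T n * C')))) := by gcongr
      _ = _ := by
        generalize Real.sqrt (D.N n) = q at hq hqq
        rw [← hqq]
        field_simp
  have hsqrt : Tendsto (fun n => (Real.sqrt (D.N n))⁻¹) atTop (𝓝 0) :=
    tendsto_inv_atTop_zero.comp (Real.tendsto_sqrt_atTop.comp
      (tendsto_natCast_atTop_atTop.comp has.N_tendsto))
  have h1 := (hsqrt.comp (tendsto_fst_probFilter (μ := μ))).const_mul 2
  have h2 := (tendsto_mul_probFilter_of_meanLe hWm hW0 hsqrt).const_mul 2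
  have h3 := (has.rate.comp (tendsto_fst_probFilter (μ := μ))).const_mul (2 * ((1 + C') * C'))
  have h4 := (h1.add h2).add h3
  simp only [mul_zero, add_zero] at h4
  refine tendsto_of_tendsto_of_tendsto_of_le_of_le' tendsto_const_nhds h4
    (Eventually.of_forall fun _ => mul_nonneg (Real.sqrt_nonneg _) (sqFrob_nonneg _)) ?_
  filter_upwards [tendsto_fst_probFilter.eventually has.eventually_N_pos,
    tendsto_fst_probFilter.eventually has.eventually_T_pos] with x hN hT
  exact hbound x.1 x.2 hN hT

/-- `√N ‖e G‖² / (N T²) → 0` in probability. -/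
theorem tendsto_sqFrob_err_mul_G (has : D.Asymptotics pr)
    (hge : ∀ n m, MeanLe μ (fun ω => (1 / (D.N n : ℝ)) * ∑ i, sqNorm (fun a =>
      (1 / Real.sqrt (D.T n)) * ∑ t, D.g n t ω a * D.e n i t ω * groupInd (D.grp n) m i)) C) :
    Tendsto (fun x : ℕ × Ω => Real.sqrt (D.N x.1) / D.T x.1 *
      (1 / ((D.N x.1 : ℝ) * D.T x.1) * sqFrob (D.err x.1 x.2 * D.G x.1 x.2)))
      (probFilter μ) (𝓝 0) := by
  -- The hypothesis is stated group by group. Each variable lies in exactly one group, so summing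
  -- over groups recovers all of `e G`.
  have h := tendsto_finsetSum (Finset.univ : Finset (Fin S)) fun m _ =>
    tendsto_mul_probFilter_of_meanLe (fun n => hge n m)
      (fun n ω => mul_nonneg (by positivity) (Finset.sum_nonneg fun i _ =>
        Finset.sum_nonneg fun a _ => sq_nonneg _)) has.rate
  simp only [Finset.sum_const_zero] at h
  refine h.congr' ?_
  filter_upwards [tendsto_fst_probFilter.eventually has.eventually_T_pos] with x hT
  have hT' : (0 : ℝ) < D.T x.1 := by exact_mod_cast hT
  rw [← Finset.mul_sum, ← Finset.mul_sum]
  congr 1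
  have h1 : ∀ m i, sqNorm (fun a => (1 / Real.sqrt (D.T x.1)) *
      ∑ t, D.g x.1 t x.2 a * D.e x.1 i t x.2 * groupInd (D.grp x.1) m i) =
      (if D.grp x.1 i = m then 1 / (D.T x.1 : ℝ) *
        ∑ a, (D.err x.1 x.2 * D.G x.1 x.2) i a ^ 2 else 0) := by
    intro m i
    unfold sqNorm groupInd
    split_ifs
    · rw [Finset.mul_sum]
      refine Finset.sum_congr rfl fun a _ => ?_
      rw [mul_pow, div_pow, Real.sq_sqrt hT'.le, one_pow]
      congr 2
      rw [Matrix.mul_apply]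
      exact Finset.sum_congr rfl fun t _ => by simp [Panel.err, Panel.G, mul_comm]
    · simp
  simp only [h1]
  rw [Finset.sum_comm]
  simp only [Finset.sum_ite_eq, Finset.mem_univ, if_true, ← Finset.mul_sum]
  rw [← mul_assoc, one_div_mul_one_div, sqFrob]

end Panel

/-! ### The loadings moments and the limit of the statistic -/

section PanelLimit

theorem transpose_mul_self_eq_sum {n r : ℕ} (M : Matrix (Fin n) (Fin r) ℝ) :
    Mᵀ * M = ∑ i, Matrix.vecMulVec (M i) (M i) := by
  ext a b
  simp [Matrix.mul_apply, Matrix.sum_apply, Matrix.vecMulVec_apply]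

variable {Ω : Type*} [MeasurableSpace Ω] {μ : Measure Ω}
  {S rc rs : ℕ} {rg : Fin S → ℕ} {D : Panel Ω S rc rs rg} {pr : Fin S → ℝ} {C : ℝ}

theorem MatTendstoP.tendsto {ι κ : Type*} {M : ℕ → Ω → Matrix ι κ ℝ} {L : Matrix ι κ ℝ}
    (h : MatTendstoP μ M L) : Tendsto (fun x : ℕ × Ω => M x.1 x.2) (probFilter μ) (𝓝 L) := by
  refine tendsto_matrix_iff.2 fun a b => ?_
  have h1 := h a b
  rw [tendstoInMeasure_const_iff] at h1
  exact h1

theorem tendsto_transpose_mul_self {r : ℕ} {T : ℕ → ℕ} {g : (n : ℕ) → Fin (T n) → Ω → Fin r → ℝ}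
    {L : Matrix (Fin r) (Fin r) ℝ} (h : MatTendstoP μ (fun n ω => (1 / (T n : ℝ)) •
      ∑ t, Matrix.vecMulVec (g n t ω) (g n t ω)) L) :
    Tendsto (fun x : ℕ × Ω => (T x.1 : ℝ)⁻¹ • ((Matrix.of fun t => g x.1 t x.2)ᵀ *
      (Matrix.of fun t => g x.1 t x.2))) (probFilter μ) (𝓝 L) := by
  refine h.tendsto.congr fun x => ?_
  rw [transpose_mul_self_eq_sum, one_div]
  rfl

/-- Law of large numbers for the second moments of the loadings in a group. -/
theorem tendsto_groupMoment_Phi [IsProbabilityMeasure μ] (has : D.Asymptotics pr)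
    (hmeas : ∀ n i, Measurable (D.phi n i)) (hindep : ∀ n, iIndepFun (fun i => D.phi n i) μ)
    (hmom : ∀ n i, MeanLe μ (fun ω => sqNorm (D.phi n i ω) ^ 2) C)
    {Psi : Fin S → Matrix (Fin D.r) (Fin D.r) ℝ}
    (hsecond : ∀ n i a b,
      HasMean μ (fun ω => D.phi n i ω a * D.phi n i ω b) (Psi (D.grp n i) a b)) (j : Fin S) :
    Tendsto (fun x : ℕ × Ω => groupMoment (D.grp x.1) (D.Phi x.1 x.2) j) (probFilter μ)
      (𝓝 (Psi j)) := by
  refine tendsto_matrix_iff.2 fun a b => ?_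
  obtain ⟨X, hX⟩ : ∃ X : (n : ℕ) → Fin (D.N n) → Ω → ℝ,
    X = fun n i ω => D.phi n i ω a * D.phi n i ω b := ⟨_, rfl⟩
  have hXmeas : ∀ n i, Measurable (X n i) := by
    intro n i
    rw [hX]
    exact ((measurable_pi_apply a).comp (hmeas n i)).mul ((measurable_pi_apply b).comp (hmeas n i))
  have hXle : ∀ n i ω, X n i ω ^ 2 ≤ sqNorm (D.phi n i ω) ^ 2 := by
    intro n i ω
    have h : ∀ c, D.phi n i ω c ^ 2 ≤ sqNorm (D.phi n i ω) := fun c =>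
      Finset.single_le_sum (f := fun c => D.phi n i ω c ^ 2) (fun _ _ => sq_nonneg _)
        (Finset.mem_univ c)
    rw [hX]
    simp only [mul_pow]
    rw [sq (sqNorm _)]
    exact mul_le_mul (h a) (h b) (sq_nonneg _) ((sq_nonneg _).trans (h a))
  have hXsq : ∀ n i, Integrable (fun ω => X n i ω ^ 2) μ := fun n i =>
    (hmom n i).1.mono' ((hXmeas n i).pow_const 2).aestronglyMeasurable
      (ae_of_all _ fun ω => by
        rw [Real.norm_eq_abs, abs_of_nonneg (sq_nonneg _)]; exact hXle n i ω)
  have hXmem : ∀ n i, MemLp (X n i) 2 μ := fun n i =>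
    (memLp_two_iff_integrable_sq (hXmeas n i).aestronglyMeasurable).2 (hXsq n i)
  have hXvar : ∀ n i, variance (X n i) μ ≤ C := fun n i =>
    (variance_le_expectation_sq (hXmeas n i).aestronglyMeasurable).trans
      ((integral_mono (hXsq n i) (hmom n i).1 (hXle n i)).trans (hmom n i).2)
  obtain ⟨s, hs⟩ : ∃ s : (n : ℕ) → Finset (Fin (D.N n)),
    s = fun n => Finset.univ.filter fun i => D.grp n i = j := ⟨_, rfl⟩
  have hcard : ∀ n, ((s n).card : ℝ) = groupSize (D.grp n) j := by intro n; rw [hs]; rfl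
  have hmean : ∀ n, ∫ ω, (∑ i ∈ s n, X n i) ω ∂μ = groupSize (D.grp n) j * Psi j a b := by
    intro n
    simp only [Finset.sum_apply]
    rw [integral_finsetSum _ fun i _ => (hXmem n i).integrable one_le_two, ← hcard,
      ← nsmul_eq_mul, ← Finset.sum_const]
    refine Finset.sum_congr rfl fun i hi => ?_
    rw [hs] at hi
    rw [hX, (hsecond n i a b).2, (Finset.mem_filter.1 hi).2]
  -- The mean of `W` is the variance of the group sum divided by the group size. By independence it
  -- is bounded, so Markov's inequality with the factor `1 / N_j` gives the law of large numbers. An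
  -- empty group makes `W` zero.
  obtain ⟨W, hW⟩ : ∃ W : ℕ → Ω → ℝ, W = fun n ω => 1 / (groupSize (D.grp n) j : ℝ) *
    ((∑ i ∈ s n, X n i) ω - groupSize (D.grp n) j * Psi j a b) ^ 2 := ⟨_, rfl⟩
  have hW0 : ∀ n ω, 0 ≤ W n ω := by intro n ω; rw [hW]; positivity
  have hWm : ∀ n, MeanLe μ (W n) (max C 0) := by
    intro n
    have hsum : MemLp (∑ i ∈ s n, X n i) 2 μ := memLp_finsetSum' _ fun i _ => hXmem n i
    have hint : Integrable (fun ω =>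
        ((∑ i ∈ s n, X n i) ω - groupSize (D.grp n) j * Psi j a b) ^ 2) μ :=
      (hsum.sub (memLp_const _)).integrable_sq
    rw [hW]
    refine ⟨hint.const_mul _, ?_⟩
    rw [integral_const_mul, ← hmean, ← variance_eq_integral hsum.aemeasurable,
      IndepFun.variance_sum (fun i _ => hXmem n i)]
    · have h1 : ∑ i ∈ s n, variance (X n i) μ ≤ groupSize (D.grp n) j * C := by
        rw [← hcard, ← nsmul_eq_mul]
        exact Finset.sum_le_card_nsmul _ _ _ fun i _ => hXvar n i
      refine (mul_le_mul_of_nonneg_left h1 (by positivity)).trans ?_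
      rcases Nat.eq_zero_or_pos (groupSize (D.grp n) j) with h | h
      · simp [h]
      · have h' : (groupSize (D.grp n) j : ℝ) ≠ 0 := by positivity
        rw [← mul_assoc, one_div_mul_cancel h', one_mul]
        exact le_max_left _ _
    · intro i _ k _ hik
      have hab : Measurable fun v : Fin D.r → ℝ => v a * v b :=
        Measurable.mul (measurable_pi_apply a) (measurable_pi_apply b)
      rw [hX]
      exact ((hindep n).indepFun hik).comp hab hab
  have hlim := tendsto_mul_probFilter_of_meanLe hWm hW0
    (tendsto_inv_atTop_zero.comp (has.groupSize_tendsto j))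
  have hlim2 : Tendsto (fun x : ℕ × Ω => groupMoment (D.grp x.1) (D.Phi x.1 x.2) j a b - Psi j a b)
      (probFilter μ) (𝓝 0) := by
    refine tendsto_zero_of_sq (hlim.congr' ?_)
    filter_upwards [tendsto_fst_probFilter.eventually
      ((has.groupSize_tendsto j).eventually_gt_atTop 0)] with x hx
    have h1 : groupMoment (D.grp x.1) (D.Phi x.1 x.2) j a b =
        1 / (groupSize (D.grp x.1) j : ℝ) * (∑ i ∈ s x.1, X x.1 i) x.2 := by
      rw [hs, hX, groupMoment_apply, Finset.sum_apply, Finset.sum_filter]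
      congr 1
      refine Finset.sum_congr rfl fun i _ => ?_
      simp [groupInd, Panel.Phi]
    rw [h1, hW]
    simp only [Function.comp_apply]
    field_simp
  simpa using hlim2.add_const (Psi j a b)

theorem transpose_inv_transpose {r : ℕ} (Z : Matrix (Fin r) (Fin r) ℝ) : ((Zᵀ)⁻¹)ᵀ = Z⁻¹ := by
  rw [Matrix.transpose_nonsing_inv, Matrix.transpose_transpose]

theorem IsPCLoadings.exists_normalized_eigenvalues {N T r : ℕ} {X : Matrix (Fin N) (Fin T) ℝ}
    {L : Matrix (Fin N) (Fin r) ℝ} (h : IsPCLoadings X L) {c : ℝ} (hc : 0 ≤ c) :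
    ∃ d : Fin r → ℝ, Antitone d ∧ (c • (X * Xᵀ)) * L = L * Matrix.diagonal d ∧
      ∀ w : Fin N → ℝ, Lᵀ *ᵥ w = 0 → ∀ l, w ⬝ᵥ ((c • (X * Xᵀ)) *ᵥ w) ≤ d l * (w ⬝ᵥ w) := by
  obtain ⟨-, v, hv1, hv2, hv3⟩ := h
  refine ⟨c • v, fun a b hab => mul_le_mul_of_nonneg_left (hv1 hab) hc, ?_, fun w hw l => ?_⟩
  · rw [Matrix.diagonal_smul, Matrix.smul_mul, hv2, Matrix.mul_smul]
  · rw [Matrix.smul_mulVec, dotProduct_smul, Pi.smul_apply, smul_eq_mul, smul_eq_mul, mul_assoc]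
    exact mul_le_mul_of_nonneg_left (hv3 w hw l) hc

/-- Deviation of the normalized covariance matrix from its common component. -/
theorem sqrt_mul_sqFrob_deviation_le {N T r : ℕ} (Φ : Matrix (Fin N) (Fin r) ℝ)
    (G : Matrix (Fin T) (Fin r) ℝ) (e : Matrix (Fin N) (Fin T) ℝ) :
    Real.sqrt N * sqFrob ((1 / ((N : ℝ) * T)) • ((Φ * Gᵀ + e) * (Φ * Gᵀ + e)ᵀ) -
      (N : ℝ)⁻¹ • (Φ * ((T : ℝ)⁻¹ • (Gᵀ * G)) * Φᵀ)) ≤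
    3 * (2 * (Real.sqrt N / T * (1 / ((N : ℝ) * T) * sqFrob (e * G)) *
      ((N : ℝ)⁻¹ • (Φᵀ * Φ)).trace) +
      Real.sqrt N * sqFrob ((1 / ((N : ℝ) * T)) • (e * eᵀ))) := by
  -- The pure factor part cancels, leaving two cross terms and the error term.
  have h5 : (1 / ((N : ℝ) * T)) • ((Φ * Gᵀ + e) * (Φ * Gᵀ + e)ᵀ) -
      (N : ℝ)⁻¹ • (Φ * ((T : ℝ)⁻¹ • (Gᵀ * G)) * Φᵀ) =
      (1 / ((N : ℝ) * T)) • (Φ * (e * G)ᵀ) + (1 / ((N : ℝ) * T)) • (e * G * Φᵀ) +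
      (1 / ((N : ℝ) * T)) • (e * eᵀ) := by
    simp only [Matrix.transpose_add, Matrix.transpose_mul, Matrix.transpose_transpose,
      Matrix.mul_add, Matrix.add_mul, Matrix.smul_mul, Matrix.mul_smul, smul_add, smul_smul,
      Matrix.mul_assoc, one_div, mul_inv]
    abel
  have h6 : sqFrob (Φ * (e * G)ᵀ) ≤ sqFrob (e * G) * sqFrob Φ := by
    refine (sqFrob_mul_le _ _).trans ?_
    rw [sqFrob_transpose, mul_comm]
  have h7 : sqFrob (e * G * Φᵀ) ≤ sqFrob (e * G) * sqFrob Φ := by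
    refine (sqFrob_mul_le _ _).trans ?_
    rw [sqFrob_transpose]
  rw [h5]
  refine (mul_le_mul_of_nonneg_left (sqFrob_add_three_le _ _ _) (Real.sqrt_nonneg _)).trans ?_
  rw [sqFrob_smul _ (Φ * _), sqFrob_smul _ (e * _ * _), Matrix.trace_smul, ← sqFrob_eq_trace,
    smul_eq_mul]
  calc _ ≤ Real.sqrt N * (3 * ((1 / ((N : ℝ) * T)) ^ 2 * (sqFrob (e * G) * sqFrob Φ) +
        (1 / ((N : ℝ) * T)) ^ 2 * (sqFrob (e * G) * sqFrob Φ) +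
        sqFrob ((1 / ((N : ℝ) * T)) • (e * eᵀ)))) := by gcongr
    _ = _ := by
        simp only [mul_inv, div_eq_mul_inv]
        ring

/-- Along any filter, the normalized statistic of a pair of groups converges if the moments of the
factors and of the rotated loadings do and the errors are negligible. -/
theorem tendsto_statLM_of_isPCLoadings {α : Type*} {F : Filter α} {r : ℕ} {N T : α → ℕ}
    {grp : (x : α) → Fin (N x) → Fin S}
    {Φ L : (x : α) → Matrix (Fin (N x)) (Fin r) ℝ} {G : (x : α) → Matrix (Fin (T x)) (Fin r) ℝ}
    {e : (x : α) → Matrix (Fin (N x)) (Fin (T x)) ℝ} {SG SPhi Xi0 : Matrix (Fin r) (Fin r) ℝ}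
    (hN : ∀ᶠ x in F, 0 < N x)
    (hshare : ∀ j, Tendsto (fun x => (groupSize (grp x) j : ℝ) / (N x : ℝ)) F (𝓝 (pr j)))
    (hpr : ∀ j, 0 < pr j)
    (hA : Tendsto (fun x => (T x : ℝ)⁻¹ • ((G x)ᵀ * G x)) F (𝓝 SG)) (hSG : SG.PosDef)
    (hB : Tendsto (fun x => (N x : ℝ)⁻¹ • ((Φ x)ᵀ * Φ x)) F (𝓝 SPhi)) (hSPhi : SPhi.PosDef)
    (hdist : DistinctEigenvalues (SG * SPhi)) (hXi : IsLimitRotation SG SPhi Xi0)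
    (heG : Tendsto (fun x => Real.sqrt (N x) / T x *
      (1 / ((N x : ℝ) * T x) * sqFrob (e x * G x))) F (𝓝 0))
    (hee : Tendsto (fun x => Real.sqrt (N x) *
      sqFrob ((1 / ((N x : ℝ) * T x)) • (e x * (e x)ᵀ))) F (𝓝 0))
    (hpc : ∀ᶠ x in F, IsPCLoadings (Φ x * (G x)ᵀ + e x) (L x)) {j k : Fin S}
    {Pj Pk : Matrix (Fin r) (Fin r) ℝ} {V : Matrix (VechIdx r) (VechIdx r) ℝ}
    (hPj : Tendsto (fun x => groupMoment (grp x) (Φ x) j) F (𝓝 Pj))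
    (hPk : Tendsto (fun x => groupMoment (grp x) (Φ x) k) F (𝓝 Pk))
    (hV : Tendsto (fun x => statS (grp x) j k (Φ x * (Xi0ᵀ)⁻¹)) F (𝓝 V)) (hVdet : IsUnit V.det) :
    Tendsto (fun x => statLM (grp x) j k (L x) / N x) F
      (𝓝 (vech (Xi0⁻¹ * (Pj - Pk) * (Xi0ᵀ)⁻¹) ⬝ᵥ
        (V⁻¹ *ᵥ vech (Xi0⁻¹ * (Pj - Pk) * (Xi0ᵀ)⁻¹)))) := by
  -- Fourth moments of the rotated loadings come from the convergence of `statS`.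
  obtain ⟨B, hm⟩ := exists_avg_pow_four_le hshare hpr hV
  have hQ : ∀ {l P}, Tendsto (fun x => groupMoment (grp x) (Φ x) l) F (𝓝 P) →
      Tendsto (fun x => groupMoment (grp x) (Φ x * (Xi0ᵀ)⁻¹) l) F
        (𝓝 (Xi0⁻¹ * P * (Xi0ᵀ)⁻¹)) := by
    intro l P h
    simp only [groupMoment_mul, transpose_inv_transpose]
    exact (h.const_mul _).mul_const _
  -- the normalized covariance matrix and its deviation from the common component
  obtain ⟨Y, hYdef⟩ : ∃ Y : (x : α) → Matrix (Fin (N x)) (Fin (N x)) ℝ, Y = fun x =>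
    (1 / ((N x : ℝ) * T x)) • ((Φ x * (G x)ᵀ + e x) * (Φ x * (G x)ᵀ + e x)ᵀ) := ⟨_, rfl⟩
  obtain ⟨E, hEdef⟩ : ∃ E : (x : α) → Matrix (Fin (N x)) (Fin (N x)) ℝ, E = fun x =>
    Y x - (N x : ℝ)⁻¹ • (Φ x * ((T x : ℝ)⁻¹ • ((G x)ᵀ * G x)) * (Φ x)ᵀ) := ⟨_, rfl⟩
  have hE : Tendsto (fun x => Real.sqrt (N x) * sqFrob (E x)) F (𝓝 0) := by
    have h3 : Tendsto (fun x => ((N x : ℝ)⁻¹ • ((Φ x)ᵀ * Φ x)).trace) F (𝓝 SPhi.trace) :=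
      (Continuous.matrix_trace continuous_id).continuousAt.tendsto.comp hB
    have h4 := (((heG.mul h3).const_mul 2).add hee).const_mul 3
    simp only [zero_mul, mul_zero, add_zero] at h4
    refine tendsto_of_tendsto_of_tendsto_of_le_of_le tendsto_const_nhds h4
      (fun _ => mul_nonneg (Real.sqrt_nonneg _) (sqFrob_nonneg _)) fun x => ?_
    rw [hEdef, hYdef]
    exact sqrt_mul_sqFrob_deviation_le _ _ _
  have hev : ∀ᶠ x in F, ∃ d : Fin r → ℝ, Antitone d ∧ Y x * L x = L x * Matrix.diagonal d ∧
      ∀ w : Fin (N x) → ℝ, (L x)ᵀ *ᵥ w = 0 → ∀ l, w ⬝ᵥ (Y x *ᵥ w) ≤ d l * (w ⬝ᵥ w) := by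
    filter_upwards [hpc] with x hx
    rw [hYdef]
    exact hx.exists_normalized_eigenvalues (by positivity)
  obtain ⟨d, hd⟩ := Filter.skolem.1 hev
  -- Different ultrafilters may produce different signs `s`, but the statistic does not see them, so
  -- the limit is the same along all of them.
  rw [tendsto_iff_ultrafilter]
  intro U hU
  obtain ⟨s, hs, hK⟩ := exists_signs_tendsto_loadings
    (hN.filter_mono hU) (hA.mono_left hU) hSG (hB.mono_left hU) hSPhi hdist hXi (hE.mono_left hU)
    (Eventually.of_forall fun x => by rw [hEdef]; exact (add_sub_cancel _ _).symm)
    ((hpc.mono fun x hx => hx.1).filter_mono hU) ((hd.mono fun x hx => hx.1).filter_mono hU)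
    ((hd.mono fun x hx => hx.2.1).filter_mono hU) ((hd.mono fun x hx => hx.2.2).filter_mono hU)
    (hm.filter_mono hU)
  have h := tendsto_statLM_of_loadings (hN.filter_mono hU) (fun j => (hshare j).mono_left hU) hpr
    (hm.filter_mono hU) hK ((hQ hPj).mono_left hU) ((hQ hPk).mono_left hU) (hV.mono_left hU) hVdet
  simp only [statLM_mul_signs _ _ _ _ hs] at h
  rw [Matrix.mul_sub, Matrix.sub_mul]
  exact h

/-- The normalized statistic of a pair of groups converges in probability. -/
theorem tendsto_statLM_div [IsProbabilityMeasure μ] (hmeas : D.IsMeasurable)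
    (has : D.Asymptotics pr)
    {SF SL H0 : Matrix (Fin rc) (Fin rc) ℝ} {V0 SLL : Matrix (VechIdx rc) (VechIdx rc) ℝ}
    (hfm : D.FactorModel μ C SF SL H0 V0 SLL)
    {SG SPhi Xi0 : Matrix (Fin D.r) (Fin D.r) ℝ} {Psi : Fin S → Matrix (Fin D.r) (Fin D.r) ℝ}
    {S0 : Fin S → Fin S → Matrix (VechIdx D.r) (VechIdx D.r) ℝ}
    (hhet : D.Heterogeneous μ C SG SPhi Xi0 Psi S0)
    {Lhat : (n : ℕ) → Ω → Matrix (Fin (D.N n)) (Fin D.r) ℝ}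
    (hLhat : ∀ᶠ n in atTop, ∀ᵐ ω ∂μ, IsPCLoadings (D.X n ω) (Lhat n ω)) {j k : Fin S}
    (hjk : j ≠ k) :
    Tendsto (fun x : ℕ × Ω => statLM (D.grp x.1) j k (Lhat x.1 x.2) / D.N x.1) (probFilter μ)
      (𝓝 (pairDelta Xi0 Psi S0 j k)) := by
  have hmom := tendsto_groupMoment_Phi has hmeas.phi hhet.phi_indep hhet.phi_moment hhet.phi_second
  have hN : ∀ᶠ x in probFilter μ, 0 < D.N x.1 :=
    tendsto_fst_probFilter.eventually has.eventually_N_pos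
  have hshare : ∀ j, Tendsto (fun x : ℕ × Ω => (groupSize (D.grp x.1) j : ℝ) / (D.N x.1 : ℝ))
      (probFilter μ) (𝓝 (pr j)) := fun j => (has.share j).comp tendsto_fst_probFilter
  have hA : Tendsto (fun x : ℕ × Ω => (D.T x.1 : ℝ)⁻¹ • ((D.G x.1 x.2)ᵀ * D.G x.1 x.2))
      (probFilter μ) (𝓝 SG) := tendsto_transpose_mul_self hhet.g_limit
  have hB : Tendsto (fun x : ℕ × Ω => (D.N x.1 : ℝ)⁻¹ • ((D.Phi x.1 x.2)ᵀ * D.Phi x.1 x.2))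
      (probFilter μ) (𝓝 SPhi) := tendsto_transpose_mul_self hhet.phi_limit
  have heG := tendsto_sqFrob_err_mul_G has hhet.ge
  have hee := tendsto_sqFrob_err_mul_transpose has hfm.e_moment hfm.e_dep hfm.e_cross
  have hpc : ∀ᶠ x in probFilter μ,
      IsPCLoadings (D.Phi x.1 x.2 * (D.G x.1 x.2)ᵀ + D.err x.1 x.2) (Lhat x.1 x.2) :=
    eventually_probFilter_of_ae hLhat
  have hV := (hhet.S0_limit j k hjk).tendsto
  have hVdet := isUnit_iff_ne_zero.2 (hhet.S0_posDef j k hjk).det_pos.ne'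
  have h := tendsto_statLM_of_isPCLoadings (F := probFilter μ) (r := D.r) (N := fun x => D.N x.1)
    (T := fun x => D.T x.1) (grp := fun x => D.grp x.1) (Φ := fun x => D.Phi x.1 x.2)
    (L := fun x => Lhat x.1 x.2) (G := fun x => D.G x.1 x.2) (e := fun x => D.err x.1 x.2)
    (SG := SG) (SPhi := SPhi) (Xi0 := Xi0) (j := j) (k := k) (Pj := Psi j) (Pk := Psi k)
    (V := S0 j k) (pr := pr)
  exact h hN hshare has.share_pos hA hhet.SG_posDef hB hhet.SPhi_posDef hhet.distinct
    hhet.rotation heG hee hpc (hmom j) (hmom k) hV hVdet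

end PanelLimit

/-! ### Positivity of the drift -/

section Drift

theorem vech_ne_zero_of_isSymm {r : ℕ} {M : Matrix (Fin r) (Fin r) ℝ} (hM : Mᵀ = M) (h0 : M ≠ 0) :
    vech M ≠ 0 := by
  intro h
  refine h0 (Matrix.ext fun a b => ?_)
  rcases le_total b a with hab | hab
  · exact congrFun h ⟨(a, b), hab⟩
  · rw [← hM]
    exact congrFun h ⟨(b, a), hab⟩

/-- `R0` is symmetric and, `Xi0` being invertible, nonzero. Its lower triangle is then nonzero, and
`(S0 j k)⁻¹` is positive definite. -/
theorem pairDelta_pos {S r : ℕ} {Xi0 : Matrix (Fin r) (Fin r) ℝ} (hXi : IsUnit Xi0.det)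
    {Psi : Fin S → Matrix (Fin r) (Fin r) ℝ}
    {S0 : Fin S → Fin S → Matrix (VechIdx r) (VechIdx r) ℝ} {j k : Fin S}
    (hS0 : (S0 j k).PosDef) (hsymm : ∀ l, (Psi l)ᵀ = Psi l) (hne : Psi j ≠ Psi k) :
    0 < pairDelta Xi0 Psi S0 j k := by
  have hXt : IsUnit Xi0ᵀ.det := by rwa [Matrix.det_transpose]
  have hR : R0 Xi0 Psi j k ≠ 0 := by
    intro h
    have h1 : Xi0 * R0 Xi0 Psi j k * Xi0ᵀ = Psi j - Psi k := by
      calc _ = (Xi0 * Xi0⁻¹) * (Psi j - Psi k) * ((Xi0ᵀ)⁻¹ * Xi0ᵀ) := by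
            simp only [R0, Matrix.mul_assoc]
        _ = _ := by
          rw [Matrix.mul_nonsing_inv _ hXi, Matrix.nonsing_inv_mul _ hXt, Matrix.one_mul,
            Matrix.mul_one]
    rw [h, Matrix.mul_zero, Matrix.zero_mul] at h1
    exact hne (sub_eq_zero.1 h1.symm)
  have hRt : (R0 Xi0 Psi j k)ᵀ = R0 Xi0 Psi j k := by
    rw [R0, Matrix.transpose_mul, Matrix.transpose_mul, Matrix.transpose_sub, hsymm, hsymm,
      transpose_inv_transpose, Matrix.transpose_nonsing_inv, Matrix.mul_assoc]
  simpa [pairDelta] using hS0.inv.dotProduct_mulVec_pos (vech_ne_zero_of_isSymm hRt hR)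

variable {Ω : Type*} [MeasurableSpace Ω] {μ : Measure Ω} [IsProbabilityMeasure μ]
  {S rc rs : ℕ} {rg : Fin S → ℕ} {D : Panel Ω S rc rs rg} {pr : Fin S → ℝ} {C : ℝ}
  {SG SPhi Xi0 : Matrix (Fin D.r) (Fin D.r) ℝ} {Psi : Fin S → Matrix (Fin D.r) (Fin D.r) ℝ}
  {S0 : Fin S → Fin S → Matrix (VechIdx D.r) (VechIdx D.r) ℝ}

/-- `Psi l` is tied to the model only through the moments of variables in group `l`. One such
variable is enough to read off symmetry and zero entries. -/
theorem exists_mem_group {Ω : Type*} {D : Panel Ω S rc rs rg} (has : D.Asymptotics pr)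
    (j : Fin S) : ∃ n i, D.grp n i = j := by
  obtain ⟨n, hn⟩ := ((has.groupSize_tendsto j).eventually_gt_atTop 0).exists
  have h : 0 < groupSize (D.grp n) j := by exact_mod_cast hn
  obtain ⟨i, hi⟩ := Finset.card_pos.1 h
  exact ⟨n, i, (Finset.mem_filter.1 hi).2⟩

/-- On the factors specific to group `j`, only the loadings of group `j` have nonzero second
moments. -/
theorem Psi_groupSpecific (hmeas : D.IsMeasurable) (has : D.Asymptotics pr)
    (hhet : D.Heterogeneous μ C SG SPhi Xi0 Psi S0) {j k : Fin S} (hjk : k ≠ j)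
    (q : Fin (rg j)) : Psi j ≠ Psi k := by
  obtain ⟨a, ha⟩ : ∃ a : Fin D.r, a = facEquiv S rc rs rg (Sum.inl (Sum.inr ⟨j, q⟩)) := ⟨_, rfl⟩
  have hphi : ∀ n i ω, D.grp n i ≠ j → D.phi n i ω a = 0 := by
    intro n i ω h
    rw [ha]
    simp [Panel.phi, stack, h]
  have hk : Psi k a a = 0 := by
    obtain ⟨n, i, hi⟩ := exists_mem_group has k
    have h := (hhet.phi_second n i a a).2
    rw [hi] at h
    rw [← h]
    simp [hphi n i _ (hi ▸ hjk)]
  have hB : Tendsto (fun x : ℕ × Ω => (D.N x.1 : ℝ)⁻¹ • ((D.Phi x.1 x.2)ᵀ * D.Phi x.1 x.2))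
      (probFilter μ) (𝓝 SPhi) := tendsto_transpose_mul_self hhet.phi_limit
  have hmom := tendsto_groupMoment_Phi has hmeas.phi hhet.phi_indep hhet.phi_moment
    hhet.phi_second j
  have hprod := ((has.share j).comp (tendsto_fst_probFilter (μ := μ))).mul
    (tendsto_matrix_iff.1 hmom a a)
  -- Only group `j` contributes to this diagonal entry of `Φᵀ Φ / N`. Since `SPhi` is positive
  -- definite, `Psi j a a` cannot vanish, whereas `Psi k a a` does.
  have heq : SPhi a a = pr j * Psi j a a := by
    refine tendsto_nhds_unique (tendsto_matrix_iff.1 hB a a) (hprod.congr' ?_)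
    filter_upwards [tendsto_fst_probFilter.eventually
      ((has.groupSize_tendsto j).eventually_gt_atTop 0)] with x hx
    rw [groupMoment_apply, Matrix.smul_apply, Matrix.mul_apply, smul_eq_mul, Function.comp_apply,
      ← mul_assoc]
    congr 1
    · field_simp
    · refine Finset.sum_congr rfl fun i _ => ?_
      by_cases h : D.grp x.1 i = j
      · simp [groupInd, h]
      · have h0 : D.Phi x.1 x.2 i a = 0 := hphi x.1 i x.2 h
        simp [h0]
  intro h
  have hpos : 0 < SPhi a a := hhet.SPhi_posDef.diag_pos
  rw [heq, h, hk, mul_zero] at hpos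
  exact lt_irrefl _ hpos

theorem pairDelta_pos_of_heterogeneousPair (hmeas : D.IsMeasurable) (has : D.Asymptotics pr)
    (hhet : D.Heterogeneous μ C SG SPhi Xi0 Psi S0) {j k : Fin S} (hjk : j ≠ k)
    (h : D.HeterogeneousPair Psi j k) : 0 < pairDelta Xi0 Psi S0 j k := by
  refine pairDelta_pos (hhet.rotation.isUnit_det hhet.SPhi_posDef) (hhet.S0_posDef j k hjk) ?_ ?_
  · intro l
    obtain ⟨n, i, hi⟩ := exists_mem_group has l
    ext a b
    have h1 := (hhet.phi_second n i a b).2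
    have h2 := (hhet.phi_second n i b a).2
    rw [hi] at h1 h2
    rw [Matrix.transpose_apply, ← h1, ← h2]
    simp only [mul_comm]
  · rcases h with h | h | ⟨a, b, h⟩ | ⟨a, b, h⟩
    · exact Psi_groupSpecific hmeas has hhet hjk.symm ⟨0, h⟩
    · exact (Psi_groupSpecific hmeas has hhet hjk ⟨0, h⟩).symm
    · exact fun h' => h (by rw [h'])
    · exact fun h' => h (by rw [h'])

end Drift

/-! ### Consistency -/

section Consistency

variable {Ω : Type*} [MeasurableSpace Ω] {μ : Measure Ω}

/-- A statistic that grows like `N δ` with `δ > 0` exceeds every bound with probability tending to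
one. -/
theorem consistent_of_tendsto_div {Z : ℕ → Ω → ℝ} {N : ℕ → ℕ} (hN : Tendsto N atTop atTop) {δ : ℝ}
    (hδ : 0 < δ)
    (h : Tendsto (fun x : ℕ × Ω => Z x.1 x.2 / N x.1) (probFilter μ) (𝓝 δ)) :
    0 < δ ∧ IsLittleOP μ (fun n ω => Z n ω - (N n : ℝ) * δ) (fun n => (N n : ℝ)) ∧
      ∀ c : ℝ, Tendsto (fun n => μ {ω | Z n ω ≤ c}) atTop (𝓝 0) := by
  have hN0 : ∀ᶠ x : ℕ × Ω in probFilter μ, (N x.1 : ℝ) ≠ 0 := by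
    filter_upwards [tendsto_fst_probFilter.eventually (hN.eventually_gt_atTop 0)] with x hx
    exact_mod_cast hx.ne'
  refine ⟨hδ, ?_, fun c => ?_⟩
  · rw [IsLittleOP, tendstoInMeasure_const_iff]
    have h1 := h.sub_const δ
    rw [sub_self] at h1
    refine h1.congr' ?_
    filter_upwards [hN0] with x hx
    field_simp
  · have hNat : Tendsto (fun x : ℕ × Ω => (N x.1 : ℝ)) (probFilter μ) atTop :=
      tendsto_natCast_atTop_atTop.comp (hN.comp tendsto_fst_probFilter)
    have h1 : ∀ᶠ x : ℕ × Ω in probFilter μ, c < Z x.1 x.2 := by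
      filter_upwards [(h.pos_mul_atTop hδ hNat).eventually_gt_atTop c, hN0] with x hx h0
      rwa [div_mul_cancel₀ _ h0] at hx
    simpa only [not_lt] using eventually_probFilter.1 h1

end Consistency

/-! ### Limits of finite maxima and minima -/

theorem tendsto_ciSup {α ι : Type*} [Fintype ι] [Nonempty ι] {F : Filter α} {f : α → ι → ℝ}
    {g : ι → ℝ} (h : ∀ i, Tendsto (fun x => f x i) F (𝓝 (g i))) :
    Tendsto (fun x => ⨆ i, f x i) F (𝓝 (⨆ i, g i)) := by
  simp only [← Finset.sup'_univ_eq_ciSup]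
  exact Tendsto.finset_sup'_nhds_apply _ fun i _ => h i

theorem tendsto_ciInf {α ι : Type*} [Fintype ι] [Nonempty ι] {F : Filter α} {f : α → ι → ℝ}
    {g : ι → ℝ} (h : ∀ i, Tendsto (fun x => f x i) F (𝓝 (g i))) :
    Tendsto (fun x => ⨅ i, f x i) F (𝓝 (⨅ i, g i)) := by
  simp only [← Finset.inf'_univ_eq_ciInf]
  exact Tendsto.finset_inf'_nhds_apply _ fun i _ => h i

end GroupFactor

/-! ### Consistency of both tests -/

theorem theorem2 {Ω : Type*} [MeasurableSpace Ω] (μ : Measure Ω) [IsProbabilityMeasure μ]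
    (S rc rs : ℕ) (hS : 2 ≤ S) (rg : Fin S → ℕ) (D : GroupFactor.Panel Ω S rc rs rg)
    (hmeas : D.IsMeasurable)
    -- sample sizes, rate condition and limiting group shares
    (pr : Fin S → ℝ) (hasym : D.Asymptotics pr)
    -- the constant bounding all moments
    (C : ℝ)
    (SF SL H0 : Matrix (Fin rc) (Fin rc) ℝ)
    (V0 SLL : Matrix (GroupFactor.VechIdx rc) (GroupFactor.VechIdx rc) ℝ)
    (hfm : D.FactorModel μ C SF SL H0 V0 SLL)
    (hwd : D.WeakDependence μ C)
    (SG SPhi Xi0 : Matrix (Fin D.r) (Fin D.r) ℝ) (Psi : Fin S → Matrix (Fin D.r) (Fin D.r) ℝ)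
    (S0 : Fin S → Fin S → Matrix (GroupFactor.VechIdx D.r) (GroupFactor.VechIdx D.r) ℝ)
    (hhet : D.Heterogeneous μ C SG SPhi Xi0 Psi S0)
    -- the principal component estimates, which exist once `N` is at least the number of factors
    (Lhat : (n : ℕ) → Ω → Matrix (Fin (D.N n)) (Fin D.r) ℝ)
    (hLhat : ∀ᶠ n in atTop, ∀ᵐ ω ∂μ, GroupFactor.IsPCLoadings (D.X n ω) (Lhat n ω))
    (delta1 delta2 : ℝ)
    (hdelta1 : delta1 =
      ⨆ p : GroupFactor.GroupPair S, GroupFactor.pairDelta Xi0 Psi S0 p.1.1 p.1.2)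
    (hdelta2 : delta2 =
      ⨅ p : GroupFactor.GroupPair S, GroupFactor.pairDelta Xi0 Psi S0 p.1.1 p.1.2) :
    ((∃ j k : Fin S, j < k ∧ D.HeterogeneousPair Psi j k) →
      0 < delta1 ∧
      GroupFactor.IsLittleOP μ
        (fun n ω => GroupFactor.statLM1 (D.grp n) (Lhat n ω) - (D.N n : ℝ) * delta1)
        (fun n => (D.N n : ℝ)) ∧
      ∀ c : ℝ, Tendsto (fun n => μ {ω | GroupFactor.statLM1 (D.grp n) (Lhat n ω) ≤ c})
        atTop (𝓝 0)) ∧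
    ((∀ j k : Fin S, j < k → D.HeterogeneousPair Psi j k) →
      0 < delta2 ∧
      GroupFactor.IsLittleOP μ
        (fun n ω => GroupFactor.statLM2 (D.grp n) (Lhat n ω) - (D.N n : ℝ) * delta2)
        (fun n => (D.N n : ℝ)) ∧
      ∀ c : ℝ, Tendsto (fun n => μ {ω | GroupFactor.statLM2 (D.grp n) (Lhat n ω) ≤ c})
        atTop (𝓝 0)) := by
  have : Nonempty (GroupFactor.GroupPair S) :=
    ⟨⟨(⟨0, by omega⟩, ⟨1, by omega⟩), by simp [Fin.lt_def]⟩⟩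
  have hlim : ∀ p : GroupFactor.GroupPair S,
      Tendsto (fun x : ℕ × Ω => GroupFactor.statLM (D.grp x.1) p.1.1 p.1.2 (Lhat x.1 x.2) / D.N x.1)
        (GroupFactor.probFilter μ) (𝓝 (GroupFactor.pairDelta Xi0 Psi S0 p.1.1 p.1.2)) := fun p =>
    GroupFactor.tendsto_statLM_div hmeas hasym hfm hhet hLhat p.2.ne
  have hnonneg : ∀ n, 0 ≤ (D.N n : ℝ)⁻¹ := fun n => inv_nonneg.2 (Nat.cast_nonneg _)
  refine ⟨fun ⟨j, k, hjk, h⟩ => ?_, fun h => ?_⟩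
  · refine GroupFactor.consistent_of_tendsto_div hasym.N_tendsto ?_ ?_
    · rw [hdelta1]
      exact (GroupFactor.pairDelta_pos_of_heterogeneousPair hmeas hasym hhet hjk.ne h).trans_le
        (le_ciSup (f := fun p : GroupFactor.GroupPair S =>
          GroupFactor.pairDelta Xi0 Psi S0 p.1.1 p.1.2) (Set.finite_range _).bddAbove ⟨(j, k), hjk⟩)
    · rw [hdelta1]
      refine (GroupFactor.tendsto_ciSup hlim).congr fun x => ?_
      -- Multiplication by the nonnegative number `N⁻¹` commutes with the maximum, also when `N =
      -- 0`.
      simp only [GroupFactor.statLM1, div_eq_mul_inv]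
      exact (Real.iSup_mul_of_nonneg (hnonneg x.1) _).symm
  · refine GroupFactor.consistent_of_tendsto_div hasym.N_tendsto ?_ ?_
    · rw [hdelta2]
      -- The minimum is attained at some pair, and under the second alternative every pair has a
      -- positive value.
      obtain ⟨p, hp⟩ := exists_eq_ciInf_of_finite (f := fun p : GroupFactor.GroupPair S =>
        GroupFactor.pairDelta Xi0 Psi S0 p.1.1 p.1.2)
      rw [← hp]
      exact GroupFactor.pairDelta_pos_of_heterogeneousPair hmeas hasym hhet p.2.ne (h _ _ p.2)
    · rw [hdelta2]
      refine (GroupFactor.tendsto_ciInf hlim).congr fun x => ?_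
      simp only [GroupFactor.statLM2, div_eq_mul_inv]
      exact (Real.iInf_mul_of_nonneg (hnonneg x.1) _).symm
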